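/- Let $a$ be a fourth-power-free integer (no fourth power of a prime divides $a$; in particular $a\ne 0$), let $E_a$ be the elliptic curve $y^2=x^3+ax$, and let $P\in E_a(\mathbb{Q})$ be a non-torsion point. For $n\ge 1$ let $B_n=B_n(E_a,P)>0$ be the denominator of $x(nP)$ in lowest terms; we say that $B_n$ has a primitive divisor if some prime divides $B_n$ but does not divide $B_1B_2\cdots B_{n-1}$. Treating $a$ as an indeterminate, let $\psi_n$ be the $n$-th division polynomial of $y^2=x^3+ax$, reduced modulo the equation of the curve, so that $\psi_n\in\mathbb{Z}[x,a]$ if $n$ is odd and $\psi_n\in y\,\mathbb{Z}[x,a]$ if $n$ is even. For $n\ge 3$ let $$\Psi_n(x)=\frac{\psi_n}{\operatorname{lcm}_{l\mid n,\ l\text{ prime}}\psi_{n/l}}\in\mathbb{Z}[x,a],$$ where the least common multiple is taken in $\mathbb{Z}[x,y,a]$ and normalized to have positive leading coefficient. Only even powers of $x$ occur in $\Psi_n(x)$, and we let $\Psi_n(X,Y)\in\mathbb{Z}[X,Y]$ be the (homogeneous) polynomial with $\Psi_n(x^2,a)=\Psi_n(x)$. For example, $\Psi_3(X,Y)=3X^2+6XY-Y^2$.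 Write $x(P)=u/v$ in lowest terms and put $$X=\frac{u^2}{\gcd(u^2,av^2)},\qquad Y=\frac{av^2}{\gcd(u^2,av^2)}.$$ Proposition. Let $n\ge 3$ be square-free and suppose that $B_n(E_a,P)$ does not have a primitive divisor. Then, for these integers $X$ and $Y$, $$\Psi_n(X,Y)=\pm\,2^{\alpha_2}\prod_{\substack{l\mid n,\ l\text{ prime}\\ l\ne 2}}l^{\alpha_l}$$ for some choice of the sign and some non-negative integers $\alpha_2$ and $\alpha_l$ with $$\alpha_2\le\tfrac{75}{4}n^2-59\qquad\text{and}\qquad \alpha_l\le\tfrac{45}{4}n^2-35 .$$ -/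

import Mathlib

open Polynomial

noncomputable section

/-- The curve `y² = x³ + a x` over a commutative ring. -/
def curveE {R : Type*} [CommRing R] (a : R) : WeierstrassCurve R :=
  { a₁ := 0, a₂ := 0, a₃ := 0, a₄ := a, a₆ := 0 }

/-- The `x`-coordinate of a rational point (with value `0` at the point at infinity). -/
def xCoord {W : WeierstrassCurve ℚ} : W.toAffine.Point → ℚ
  | .zero => 0
  | .some x _ _ => x

/-- `B_n(E, P)`: the positive denominator of `x(nP)` in lowest terms. -/
def edsB {W : WeierstrassCurve ℚ} (P : W.toAffine.Point) (n : ℕ) : ℕ :=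
  (xCoord (n • P)).den

/-- The `n`-th term of a sequence `x_1, x_2, …` has a primitive divisor: some prime divides `x_n`
but does not divide `x_1 ⋯ x_{n-1}`. -/
def HasPrimitiveDivisor (x : ℕ → ℕ) (n : ℕ) : Prop :=
  ∃ p : ℕ, p.Prime ∧ p ∣ x n ∧ ¬ p ∣ ∏ k ∈ Finset.Ico 1 n, x k

/-- An integer is fourth-power-free if no fourth power of a prime divides it (so it is nonzero). -/
def FourthPowerFree (a : ℤ) : Prop :=
  ∀ p : ℕ, p.Prime → ¬ (p : ℤ) ^ 4 ∣ a

/-- The division polynomial `ψ_n` of `y² = x³ + a x` as an element of `ℤ[a][x][y]`, with `a` an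
indeterminate. It is reduced by means of the equation of the curve, so it is a polynomial in
`ℤ[a][x]` for odd `n`, and `y` times such a polynomial for even `n`. -/
def divPoly (n : ℕ) : ℤ[X][X][X] :=
  (curveE (X : ℤ[X])).Ψ n

/-- The least common multiple of the `ψ_{n/l}`, for `l` a prime divisor of `n`, in the unique
factorization domain `ℤ[a][x][y]` (normalized to have positive leading coefficient). -/
def divPolyLcm (n : ℕ) : ℤ[X][X][X] :=
  n.primeFactors.lcm fun l => divPoly (n / l)

open Classical in
/-- The exact quotient `f / g` of two elements of an integral domain, `g ≠ 0` (and `0` if `g` does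
not divide `f`). -/
def exactQuot {R : Type*} [CommRing R] (f g : R) : R :=
  if h : g ∣ f then h.choose else 0

/-- `Ψ_n(x) = ψ_n / lcm_{l ∣ n} ψ_{n/l}`, an element of `ℤ[a][x]`. The quotient depends only on `x`
for `n > 2`, and so is its own coefficient of `y⁰`. -/
def primPsi (n : ℕ) : ℤ[X][X] :=
  (exactQuot (divPoly n) (divPolyLcm n)).coeff 0

/-- The two-variable polynomial `Ψ_n(X, Y)`, an element of `ℤ[Y][X]` (the outer variable is `X`).
It is the polynomial with `Ψ_n(x², a) = Ψ_n(x)`: as only even powers of `x` occur in `Ψ_n(x)`,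
it is obtained by the substitutions `x² ↦ X` and `a ↦ Y`. It is homogeneous, and `Ψ_n(u², a v²)` is
the homogenization `F_n(u, v, a)` of `Ψ_n(x)`. -/
def biPsi (n : ℕ) : ℤ[X][X] :=
  contract 2 (primPsi n)

/-- The value of `Ψ_n(X, Y)` at the integers `X`, `Y`. -/
def psiVal (n : ℕ) (x y : ℤ) : ℤ :=
  (biPsi n).evalEval y x

/-- For `x(P) = u / v` in lowest terms, `X = u² / gcd(u², a v²)`. -/
def coordX (a : ℤ) (q : ℚ) : ℤ :=
  q.num ^ 2 / (Int.gcd (q.num ^ 2) (a * (q.den : ℤ) ^ 2) : ℤ)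

/-- For `x(P) = u / v` in lowest terms, `Y = a v² / gcd(u², a v²)`. -/
def coordY (a : ℤ) (q : ℚ) : ℤ :=
  a * (q.den : ℤ) ^ 2 / (Int.gcd (q.num ^ 2) (a * (q.den : ℤ) ^ 2) : ℤ)

end

/-!
Let `W_k` be the values of the division polynomials `ψ_k` at `P`. As `ψ_n = Ψ_n · lcm ψ_{n/l}`, a
lower bound for `‖W_n‖`, or for `‖W_n‖ / ‖W_{n/l}‖` with a single prime `l ∣ n`, at a place above
`p` is a lower bound for `‖Ψ_n‖`, that is, an upper bound for the exponent of `p` in `Ψ_n(X, Y)`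
(`IsKummerSeq.norm_kummerW_le_norm_psiVal`). Since `Ψ_n` is homogeneous in `x²` and `a`, the point
may be rescaled by `x ↦ c² x` over an algebraic closure of `ℚ_p`, where `c⁴ = v² / gcd(u², a v²)`.
After this the curve is `y² = x³ + Y x`, the abscissa of the point is a square root of `X`,
everything is integral, and `X`, `Y` are coprime.

The numerator `φ_m` and the denominator `ψ_m²` of `x(m P)` on this model have no common factor at
the odd primes, and only a bounded power of `2` in common, at most `2 ^ (3 m² / 4)`. Indeed, a
common zero of `φ_m` and `ψ_m` in the residue field forces a singular reduction of `P`
(`IsKummerSeq.not_norm_lt_one`). The coprimality of `X` and `Y` excludes this at odd primes, and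
at `2` the point `2 P` has nonsingular reduction (`IsKummerSeq.pow_le_max_of_prime_two`).

If `p` does not divide `B_n`, then `φ_n` is not much larger than `ψ_n²`, because `a` is
fourth-power-free, so that the bound on common factors bounds `ψ_n` from below. If `p` divides
`B_n`, then it is not a primitive divisor. The indices of the multiples which reduce to infinity
are closed under gcd's, so `(n / l) P` reduces to infinity for some prime `l ∣ n`
(`IsKummerSeq.exists_prime_one_lt_norm`). With `m = n / l`, the leading term of `ψ_l` dominates
its value at `m P`, and so `ψ_n` has the norm of `l φ_m ^ ((l² - 1) / 2) ψ_m`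
(`IsKummerSeq.norm_kummerW_mul_odd`; for `l = 2` the duplication formula is used). Here `φ_m` is
bounded from below by the bound on common factors. Altogether, the exponent of an odd prime is at
most `1`, and `0` unless the prime divides `n`, while the exponent of `2` is at most `1 + 3 n² /
8` (`odd_prime_estimate`, `two_estimate`).

Identities between values of division polynomials are derived from the formulas for the abscissas
of sums, differences and doubles alone (`IsKummerSeq`), which determine the sequence `W_k` by
`W_{k+1} W_{k-1} = (x_1 - x_k) W_k²` (`kummerW`, `IsKummerSeq.kummerW_eq_normEDS`). The
divisibility `ψ_{n/l} ∣ ψ_n` in `ℤ[a][x][y]` follows by specialization to points of infinite order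
(`preΨ'_mul_odd`), and the evenness of `Ψ_n(x)` from that of the division polynomials and `ψ_n(0)
≠ 0` (`primPsi_comp_neg`).
-/

/-! ### Sequences of abscissas and their elliptic sequences -/

/-- `x` is the sequence of abscissas `x(P), x(2P), x(3P), …` (from index `1` on) of the multiples of
a point of infinite order on `y² = x³ + a x`, recorded through the formulas which the abscissas of
sums, differences and doubles satisfy. -/
structure IsKummerSeq {K : Type*} [Field K] (a : K) (x : ℕ → K) : Prop where
  ne : ∀ ⦃i j : ℕ⦄, 1 ≤ j → j < i → x i ≠ x j
  add : ∀ ⦃i j : ℕ⦄, 1 ≤ j → j < i →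
    (x (i + j) + x (i - j)) * (x i - x j) ^ 2 = 2 * (x i + x j) * (x i * x j + a)
  mul : ∀ ⦃i j : ℕ⦄, 1 ≤ j → j < i →
    x (i + j) * x (i - j) * (x i - x j) ^ 2 = (x i * x j - a) ^ 2
  dup : ∀ ⦃i : ℕ⦄, 1 ≤ i → x (2 * i) * (4 * (x i ^ 3 + a * x i)) = (x i ^ 2 - a) ^ 2
  dup_ne : ∀ ⦃i : ℕ⦄, 1 ≤ i → 4 * (x i ^ 3 + a * x i) ≠ 0

/-- The elliptic sequence attached to a sequence of abscissas: `W₀ = 0`, `W₁ = 1`, `W₂ = b` and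
`Wₙ₊₁ Wₙ₋₁ = (x₁ - xₙ) Wₙ²`. -/
def kummerW {K : Type*} [Field K] (x : ℕ → K) (b : K) : ℕ → K
  | 0 => 0
  | 1 => 1
  | 2 => b
  | n + 3 => (x 1 - x (n + 2)) * kummerW x b (n + 2) ^ 2 / kummerW x b (n + 1)

namespace IsKummerSeq

variable {K : Type*} [Field K] {a b : K} {x : ℕ → K}

lemma scale (h : IsKummerSeq a x) {c : K} (hc : c ≠ 0) :
    IsKummerSeq (c ^ 2 * a) (fun k => c * x k) where
  ne i j hj hij e := h.ne hj hij (mul_left_cancel₀ hc e)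
  add i j hj hij := by linear_combination c ^ 3 * h.add hj hij
  mul i j hj hij := by linear_combination c ^ 4 * h.mul hj hij
  dup i hi := by linear_combination c ^ 4 * h.dup hi
  dup_ne i hi e := by
    refine h.dup_ne hi (mul_left_cancel₀ (pow_ne_zero 3 hc) ?_)
    linear_combination e

lemma subseq (h : IsKummerSeq a x) {m : ℕ} (hm : 1 ≤ m) :
    IsKummerSeq a (fun k => x (m * k)) where
  ne i j hj hij := h.ne (Nat.mul_pos hm hj) (Nat.mul_lt_mul_of_pos_left hij hm)
  add i j hj hij := by
    have := h.add (Nat.mul_pos hm hj) (Nat.mul_lt_mul_of_pos_left hij hm)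
    rwa [← Nat.mul_sub, ← Nat.mul_add] at this
  mul i j hj hij := by
    have := h.mul (Nat.mul_pos hm hj) (Nat.mul_lt_mul_of_pos_left hij hm)
    rwa [← Nat.mul_sub, ← Nat.mul_add] at this
  dup i hi := by
    have := h.dup (Nat.mul_pos hm hi)
    rwa [Nat.mul_left_comm 2 m i] at this
  dup_ne i hi := h.dup_ne (Nat.mul_pos hm hi)

lemma map (h : IsKummerSeq a x) {L : Type*} [Field L] (f : K →+* L) :
    IsKummerSeq (f a) (fun k => f (x k)) where
  ne i j hj hij e := h.ne hj hij (f.injective e)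
  add i j hj hij := by simpa [map_ofNat] using congrArg f (h.add hj hij)
  mul i j hj hij := by simpa using congrArg f (h.mul hj hij)
  dup i hi := by simpa [map_ofNat] using congrArg f (h.dup hi)
  dup_ne i hi e := h.dup_ne hi (f.injective (by rw [map_zero, ← e]; simp [map_ofNat]))

/-- The expression on the left is symmetric in the three points with abscissas `t`, `x i`, `x j`. -/
lemma sub_mul_sub (h : IsKummerSeq a x) {i j : ℕ} (hj : 1 ≤ j) (hij : j < i) (t : K) :
    (t - x (i + j)) * (t - x (i - j)) * (x i - x j) ^ 2 =
      t ^ 2 * (x i - x j) ^ 2 - 2 * (x i + x j) * (x i * x j + a) * t + (x i * x j - a) ^ 2 := by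
  linear_combination -t * h.add hj hij + h.mul hj hij

lemma kummerW_ne_zero (h : IsKummerSeq a x) (hb : b ^ 2 = 4 * (x 1 ^ 3 + a * x 1)) :
    ∀ n : ℕ, kummerW x b (n + 1) ≠ 0
  | 0 => by simp [kummerW]
  | 1 => by
    intro e
    simp only [kummerW] at e
    exact h.dup_ne le_rfl (by rw [← hb, e]; ring)
  | n + 2 => by
    have h1 := kummerW_ne_zero h hb n
    have h2 := kummerW_ne_zero h hb (n + 1)
    have h3 := h.ne (i := n + 2) le_rfl (by omega)
    rw [kummerW]
    exact div_ne_zero (mul_ne_zero (sub_ne_zero.2 h3.symm) (pow_ne_zero 2 h2)) h1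

lemma kummerW_ne_zero' (h : IsKummerSeq a x) (hb : b ^ 2 = 4 * (x 1 ^ 3 + a * x 1)) {n : ℕ}
    (hn : 1 ≤ n) : kummerW x b n ≠ 0 := by
  obtain ⟨n, rfl⟩ := Nat.exists_eq_add_of_le' hn
  exact h.kummerW_ne_zero hb n

lemma kummerW_step (h : IsKummerSeq a x) (hb : b ^ 2 = 4 * (x 1 ^ 3 + a * x 1)) (n : ℕ) :
    kummerW x b (n + 2) * kummerW x b n = (x 1 - x (n + 1)) * kummerW x b (n + 1) ^ 2 := by
  cases n with
  | zero => simp [kummerW]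
  | succ n => rw [kummerW, div_mul_cancel₀ _ (h.kummerW_ne_zero hb n)]

/-- The elliptic relation `W_{i+j} W_{i-j} = (x_j - x_i) W_i² W_j²`, with `i = j + d`. -/
lemma kummerW_rel (h : IsKummerSeq a x) (hb : b ^ 2 = 4 * (x 1 ^ 3 + a * x 1)) :
    ∀ j d : ℕ, kummerW x b (2 * (j + 1) + d) * kummerW x b d =
      (x (j + 1) - x (j + 1 + d)) * kummerW x b (j + 1 + d) ^ 2 * kummerW x b (j + 1) ^ 2
  | j, 0 => by simp [kummerW]
  | 0, d + 1 => by
    have := h.kummerW_step hb (d + 1)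
    rw [show 2 * (0 + 1) + (d + 1) = d + 1 + 2 by ring, this,
      show 0 + 1 + (d + 1) = d + 1 + 1 by ring]
    simp [kummerW]
  | 1, d + 1 => by
    have e1 := h.kummerW_step hb (d + 3)
    have e2 := h.kummerW_step hb (d + 1)
    have e3 := h.kummerW_step hb (d + 2)
    have hs := h.sub_mul_sub (i := d + 3) (j := 1) le_rfl (by omega) (x 1)
    have hd := h.dup le_rfl
    have hb2 : kummerW x b (1 + 1) = b := by simp [kummerW]
    rw [show d + 3 - 1 = d + 2 by omega] at hs
    refine mul_right_cancel₀ (pow_ne_zero 2 (h.kummerW_ne_zero hb (d + 2))) ?_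
    rw [show 2 * (1 + 1) + (d + 1) = d + 3 + 2 by ring, show 1 + 1 + (d + 1) = d + 3 by ring, hb2]
    generalize kummerW x b (d + 3 + 2) = w₅ at *
    generalize kummerW x b (d + 1) = w₁ at *
    linear_combination
      kummerW x b (d + 3) * w₁ * e1 +
      (x 1 - x (d + 4)) * kummerW x b (d + 4) ^ 2 * e2 +
      (x 1 - x (d + 4)) * (x 1 - x (d + 2)) *
        (kummerW x b (d + 4) * kummerW x b (d + 2) +
          (x 1 - x (d + 3)) * kummerW x b (d + 3) ^ 2) * e3 +
      kummerW x b (d + 3) ^ 4 * (hs - hd - (x 2 - x (d + 3)) * hb)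
  | j + 2, d + 1 => by
    have r1 := kummerW_rel h hb (j + 1) (d + 2)
    have r0 := kummerW_rel h hb j (d + 3)
    have s1 := h.kummerW_step hb (2 * j + d + 5)
    have s2 := h.kummerW_step hb (d + 1)
    have s3 := h.kummerW_step hb (j + 1)
    have hA := h.sub_mul_sub (i := j + d + 4) (j := j + 2) (by omega) (by omega) (x 1)
    have hB := h.sub_mul_sub (i := j + 2) (j := 1) le_rfl (by omega) (x (j + d + 4))
    rw [show j + d + 4 + (j + 2) = 2 * j + d + 6 by ring,
      show j + d + 4 - (j + 2) = d + 2 by omega] at hA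
    rw [show j + 2 - 1 = j + 1 by omega] at hB
    rw [show 2 * (j + 1 + 1) + (d + 2) = 2 * j + d + 6 by ring,
      show j + 1 + 1 + (d + 2) = j + d + 4 by ring] at r1
    rw [show 2 * (j + 1) + (d + 3) = 2 * j + d + 5 by ring,
      show j + 1 + (d + 3) = j + d + 4 by ring] at r0
    rw [show 2 * (j + 2 + 1) + (d + 1) = 2 * j + d + 7 by ring,
      show j + 2 + 1 + (d + 1) = j + d + 4 by ring]
    have hne : kummerW x b (2 * j + d + 5) * kummerW x b (d + 3) ≠ 0 :=
      mul_ne_zero (h.kummerW_ne_zero hb _) (h.kummerW_ne_zero hb _)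
    refine mul_right_cancel₀ hne ?_
    have key : kummerW x b (2 * j + d + 7) * kummerW x b (2 * j + d + 5) *
        (kummerW x b (d + 3) * kummerW x b (d + 1)) =
        (x (j + 3) - x (j + d + 4)) * kummerW x b (j + d + 4) ^ 2 * kummerW x b (j + 3) ^ 2 *
          ((x (j + 1) - x (j + d + 4)) * kummerW x b (j + d + 4) ^ 2 *
            kummerW x b (j + 1) ^ 2) := by
      rw [s1, s2]
      trans (x 1 - x (2 * j + d + 6)) * (x 1 - x (d + 2)) *
        (kummerW x b (2 * j + d + 6) * kummerW x b (d + 2)) ^ 2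
      · ring
      rw [r1]
      trans (x (j + 3) - x (j + d + 4)) * (x (j + 1) - x (j + d + 4)) *
        kummerW x b (j + d + 4) ^ 4 * (kummerW x b (j + 3) * kummerW x b (j + 1)) ^ 2
      · rw [s3]
        linear_combination kummerW x b (j + d + 4) ^ 4 * kummerW x b (j + 2) ^ 4 * (hA - hB)
      · ring
    rw [← r0] at key
    linear_combination key

/-- `x_n W_n²` is the value of the numerator polynomial of multiplication by `n`. -/
lemma mul_kummerW_sq (h : IsKummerSeq a x) (hb : b ^ 2 = 4 * (x 1 ^ 3 + a * x 1)) (n : ℕ) :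
    x (n + 1) * kummerW x b (n + 1) ^ 2 =
      x 1 * kummerW x b (n + 1) ^ 2 - kummerW x b (n + 2) * kummerW x b n := by
  rw [h.kummerW_step hb]; ring

lemma kummerW_odd (h : IsKummerSeq a x) (hb : b ^ 2 = 4 * (x 1 ^ 3 + a * x 1)) (m : ℕ) :
    kummerW x b (2 * (m + 1) + 1) =
      (x (m + 1) - x (m + 2)) * kummerW x b (m + 2) ^ 2 * kummerW x b (m + 1) ^ 2 := by
  have := h.kummerW_rel hb m 1
  rwa [show kummerW x b 1 = 1 by simp [kummerW], mul_one] at this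

/-- The elliptic sequence of a sequence of abscissas is the normalised elliptic divisibility
sequence whose initial terms are the values of the division polynomials. -/
lemma kummerW_eq_normEDS (h : IsKummerSeq a x) (hb : b ^ 2 = 4 * (x 1 ^ 3 + a * x 1)) (n : ℕ) :
    kummerW x b n = normEDS b (3 * x 1 ^ 4 + 6 * a * x 1 ^ 2 - a ^ 2)
      (2 * x 1 ^ 6 + 10 * a * x 1 ^ 4 - 10 * a ^ 2 * x 1 ^ 2 - 2 * a ^ 3) n := by
  have w1 : kummerW x b 1 = 1 := by simp [kummerW]
  have w2 : kummerW x b 2 = b := by simp [kummerW]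
  have b0 : b ≠ 0 := by simpa [kummerW] using h.kummerW_ne_zero hb 1
  have hd := h.dup le_rfl
  have w3 : kummerW x b 3 = 3 * x 1 ^ 4 + 6 * a * x 1 ^ 2 - a ^ 2 := by
    have := h.kummerW_step hb 1
    rw [w1, w2, hb] at this
    linear_combination this - hd
  induction n using normEDSRec with
  | zero => simp [kummerW]
  | one => simp [kummerW]
  | two => simp [kummerW]
  | three => simpa using w3
  | four =>
    have s := h.kummerW_step hb 2
    have hA := h.add (i := 2) (j := 1) le_rfl (by omega)
    have hw3 := h.kummerW_step hb 1
    rw [show ((4 : ℕ) : ℤ) = 4 by rfl, normEDS_four]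
    refine mul_right_cancel₀ b0 ?_
    rw [w1, w2, mul_one] at hw3
    rw [w2, hw3] at s
    simp only [Nat.reduceAdd, Nat.reduceSub, mul_one] at *
    rw [← hb] at hd
    have e : kummerW x b 4 * b = 2 * x 1 * (x 1 * b ^ 2 - (x 1 ^ 2 - a) ^ 2) ^ 2 -
        2 * (x 1 * b ^ 2 + (x 1 ^ 2 - a) ^ 2) * (x 1 * (x 1 ^ 2 - a) ^ 2 + a * b ^ 2) := by
      rw [← hd]; linear_combination s - b ^ 4 * hA
    rw [e, mul_assoc _ b b, ← sq b, hb]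
    ring
  | even m h1 h2 h3 h4 h5 =>
    have e := normEDS_even b (3 * x 1 ^ 4 + 6 * a * x 1 ^ 2 - a ^ 2)
      (2 * x 1 ^ 6 + 10 * a * x 1 ^ 4 - 10 * a ^ 2 * x 1 ^ 2 - 2 * a ^ 3) (m + 3)
    rw [show ((m : ℤ) + 3 - 1) = (m + 2 : ℕ) by push_cast; ring,
      show ((m : ℤ) + 3 - 2) = (m + 1 : ℕ) by push_cast; ring,
      show ((m : ℤ) + 3 + 2) = (m + 5 : ℕ) by push_cast; ring,
      show ((m : ℤ) + 3 + 1) = (m + 4 : ℕ) by push_cast; ring,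
      show (2 * ((m : ℤ) + 3)) = (2 * (m + 3) : ℕ) by push_cast; ring,
      show ((m : ℤ) + 3) = (m + 3 : ℕ) by push_cast; ring, ← h1, ← h2, ← h3, ← h4, ← h5] at e
    refine mul_right_cancel₀ b0 (Eq.trans ?_ e.symm)
    have r := h.kummerW_rel hb (m + 1) 2
    rw [w2, show 2 * (m + 1 + 1) + 2 = 2 * (m + 3) by ring, show m + 1 + 1 + 2 = m + 4 by ring,
      show m + 1 + 1 = m + 2 by ring] at r
    have s1 := h.kummerW_step hb (m + 3)
    have s2 := h.kummerW_step hb (m + 1)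
    rw [r]
    linear_combination kummerW x b (m + 4) ^ 2 * s2 - kummerW x b (m + 2) ^ 2 * s1
  | odd m h1 h2 h3 h4 =>
    have e := normEDS_odd b (3 * x 1 ^ 4 + 6 * a * x 1 ^ 2 - a ^ 2)
      (2 * x 1 ^ 6 + 10 * a * x 1 ^ 4 - 10 * a ^ 2 * x 1 ^ 2 - 2 * a ^ 3) (m + 2)
    rw [show ((m : ℤ) + 2 - 1) = (m + 1 : ℕ) by push_cast; ring,
      show ((m : ℤ) + 2 + 2) = (m + 4 : ℕ) by push_cast; ring,
      show ((m : ℤ) + 2 + 1) = (m + 3 : ℕ) by push_cast; ring,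
      show (2 * ((m : ℤ) + 2) + 1) = (2 * (m + 2) + 1 : ℕ) by push_cast; ring,
      show ((m : ℤ) + 2) = (m + 2 : ℕ) by push_cast; ring, ← h1, ← h2, ← h3, ← h4] at e
    refine Eq.trans ?_ e.symm
    rw [show 2 * (m + 2) + 1 = 2 * (m + 1 + 1) + 1 by ring, h.kummerW_odd hb]
    have s1 := h.kummerW_step hb (m + 2)
    have s2 := h.kummerW_step hb (m + 1)
    rw [show m + 1 + 1 = m + 2 by ring, show m + 1 + 2 = m + 3 by ring] at *
    linear_combination kummerW x b (m + 3) ^ 2 * s2 - kummerW x b (m + 2) ^ 2 * s1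

/-- The duplication formula for the ordinate. -/
lemma kummerW_two_mul_sq (h : IsKummerSeq a x) (hb : b ^ 2 = 4 * (x 1 ^ 3 + a * x 1)) {m : ℕ}
    (hm : 1 ≤ m) :
    kummerW x b (2 * m) ^ 2 = 4 * (x m ^ 3 + a * x m) * kummerW x b m ^ 8 := by
  obtain rfl | hm' := hm.eq_or_lt
  · simp [kummerW, hb]
  obtain ⟨m, rfl⟩ := Nat.exists_eq_add_of_le' hm'
  have o1 := h.kummerW_odd hb (m + 1)
  have o2 := h.kummerW_odd hb m
  have s := h.kummerW_step hb (m + 1)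
  have t := h.kummerW_step hb (2 * m + 3)
  have hs := h.sub_mul_sub (i := m + 2) (j := 1) le_rfl (by omega) (x (m + 2))
  have hd := h.dup (i := m + 2) (by omega)
  have hne := sub_ne_zero.2 (h.ne (i := 2 * (m + 2)) (j := 1) le_rfl (by omega)).symm
  rw [show 2 * (m + 1 + 1) + 1 = 2 * m + 3 + 2 by ring] at o1
  rw [show 2 * (m + 1) + 1 = 2 * m + 3 by ring] at o2
  rw [show m + 2 - 1 = m + 1 by omega] at hs
  rw [show 2 * m + 3 + 1 = 2 * (m + 2) by ring, o1, o2] at t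
  refine mul_left_cancel₀ hne ?_
  rw [← t]
  trans -((x (m + 2) - x (m + 2 + 1)) * (x (m + 2) - x (m + 1)) * kummerW x b (m + 2) ^ 4 *
    (kummerW x b (m + 1 + 2) * kummerW x b (m + 1)) ^ 2)
  · ring
  rw [s]
  linear_combination kummerW x b (m + 2) ^ 8 * (hd - hs)

/-- Passing from `P` to `m P` divides the elliptic sequence by powers of `W_m`. -/
lemma kummerW_mul (h : IsKummerSeq a x) (hb : b ^ 2 = 4 * (x 1 ^ 3 + a * x 1)) {m : ℕ}
    (hm : 1 ≤ m) {b' : K} (hb' : kummerW x b (2 * m) = b' * kummerW x b m ^ 4) :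
    ∀ k : ℕ, kummerW x b (m * k) = kummerW (fun k => x (m * k)) b' k * kummerW x b m ^ k ^ 2
  | 0 => by simp [kummerW]
  | 1 => by simp [kummerW]
  | 2 => by simp [kummerW, mul_comm m, hb']
  | k + 3 => by
    have i1 := kummerW_mul h hb hm hb' (k + 1)
    have i2 := kummerW_mul h hb hm hb' (k + 2)
    have n1 : kummerW x b (m * (k + 1)) ≠ 0 := h.kummerW_ne_zero' hb (Nat.mul_pos hm k.succ_pos)
    obtain ⟨m, rfl⟩ := Nat.exists_eq_add_of_le' hm
    have r := h.kummerW_rel hb m ((m + 1) * (k + 1))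
    rw [show 2 * (m + 1) + (m + 1) * (k + 1) = (m + 1) * (k + 3) by ring,
      show m + 1 + (m + 1) * (k + 1) = (m + 1) * (k + 2) by ring] at r
    refine mul_right_cancel₀ n1 ?_
    have n2 := n1
    rw [i1] at n2
    have n3 := left_ne_zero_of_mul n2
    rw [r, i2, i1, kummerW]
    field_simp
    ring_nf

lemma exists_kummerW_mul (h : IsKummerSeq a x) (hb : b ^ 2 = 4 * (x 1 ^ 3 + a * x 1)) {m : ℕ}
    (hm : 1 ≤ m) : ∃ b' : K, b' ^ 2 = 4 * (x m ^ 3 + a * x m) ∧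
      ∀ k, kummerW x b (m * k) = kummerW (fun k => x (m * k)) b' k * kummerW x b m ^ k ^ 2 := by
  have hWm := h.kummerW_ne_zero' hb hm
  refine ⟨kummerW x b (2 * m) / kummerW x b m ^ 4, ?_,
    h.kummerW_mul hb hm (div_mul_cancel₀ _ (pow_ne_zero 4 hWm)).symm⟩
  rw [div_pow, h.kummerW_two_mul_sq hb hm]
  field_simp

lemma kummerW_scale (c : K) (hc : c ≠ 0) :
    ∀ k : ℕ, kummerW (fun k => c ^ 2 * x k) (c ^ 3 * b) k * c = kummerW x b k * c ^ k ^ 2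
  | 0 => by simp [kummerW]
  | 1 => by simp [kummerW]
  | 2 => by simp [kummerW]; ring
  | k + 3 => by
    have i1 := eq_div_of_mul_eq hc (kummerW_scale c hc (k + 1))
    have i2 := eq_div_of_mul_eq hc (kummerW_scale c hc (k + 2))
    rw [kummerW, i1, i2, kummerW]
    by_cases h0 : kummerW x b (k + 1) = 0
    · simp [h0]
    · field_simp
      ring

end IsKummerSeq

/-! ### Abscissas of the multiples of a point -/

section
variable {K : Type*} [Field K] {a : K}

/-- The abscissa of a point, with value `0` at the point at infinity. -/
def absc {W : WeierstrassCurve K} : W.toAffine.Point → K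
  | .zero => 0
  | .some x _ _ => x

lemma curveE_equation {x y : K} (h : (curveE a).toAffine.Equation x y) : y ^ 2 = x ^ 3 + a * x := by
  rw [WeierstrassCurve.Affine.equation_iff] at h
  simpa [curveE] using h

lemma absc_eq_imp {P Q : (curveE a).toAffine.Point} (hP : P ≠ 0) (hQ : Q ≠ 0)
    (h : absc P = absc Q) : P = Q ∨ P = -Q := by
  rcases P with _ | ⟨x₁, y₁, h₁⟩
  · exact absurd rfl hP
  rcases Q with _ | ⟨x₂, y₂, h₂⟩
  · exact absurd rfl hQ
  exact WeierstrassCurve.Affine.Point.X_eq_iff.1 h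

variable [DecidableEq K]

lemma absc_add_sub {P Q : (curveE a).toAffine.Point} (hP : P ≠ 0) (hQ : Q ≠ 0)
    (h : absc P ≠ absc Q) :
    (absc (P + Q) + absc (P - Q)) * (absc P - absc Q) ^ 2 =
      2 * (absc P + absc Q) * (absc P * absc Q + a) ∧
    absc (P + Q) * absc (P - Q) * (absc P - absc Q) ^ 2 = (absc P * absc Q - a) ^ 2 := by
  rcases P with _ | ⟨x₁, y₁, h₁⟩
  · exact absurd rfl hP
  rcases Q with _ | ⟨x₂, y₂, h₂⟩
  · exact absurd rfl hQ
  have hx : x₁ ≠ x₂ := h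
  have e₁ := curveE_equation h₁.1
  have e₂ := curveE_equation h₂.1
  have hx' : x₁ - x₂ ≠ 0 := sub_ne_zero.2 hx
  have hp : absc (.some x₁ y₁ h₁ + .some x₂ y₂ h₂) = ((y₁ - y₂) / (x₁ - x₂)) ^ 2 - x₁ - x₂ := by
    rw [WeierstrassCurve.Affine.Point.add_of_X_ne hx]
    simp [absc, WeierstrassCurve.Affine.slope_of_X_ne hx, WeierstrassCurve.Affine.addX, curveE]
  have hm : absc (.some x₁ y₁ h₁ - .some x₂ y₂ h₂) = ((y₁ + y₂) / (x₁ - x₂)) ^ 2 - x₁ - x₂ := by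
    rw [sub_eq_add_neg, WeierstrassCurve.Affine.Point.neg_some,
      WeierstrassCurve.Affine.Point.add_of_X_ne hx]
    simp [absc, WeierstrassCurve.Affine.slope_of_X_ne hx, WeierstrassCurve.Affine.addX, curveE,
      WeierstrassCurve.Affine.negY]
  rw [hp, hm]
  simp only [absc]
  constructor
  · field_simp
    linear_combination 2 * e₁ + 2 * e₂
  · field_simp
    linear_combination
      (y₁ ^ 2 - y₂ ^ 2 + (x₁ ^ 3 + a * x₁) - (x₂ ^ 3 + a * x₂) -
        2 * (x₁ + x₂) * (x₁ - x₂) ^ 2) * e₁ -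
      (y₁ ^ 2 - y₂ ^ 2 + (x₁ ^ 3 + a * x₁) - (x₂ ^ 3 + a * x₂) +
        2 * (x₁ + x₂) * (x₁ - x₂) ^ 2) * e₂

lemma absc_two_nsmul {P : (curveE a).toAffine.Point} (hP : (2 : ℕ) • P ≠ 0) :
    4 * (absc P ^ 3 + a * absc P) ≠ 0 ∧
    absc ((2 : ℕ) • P) * (4 * (absc P ^ 3 + a * absc P)) = (absc P ^ 2 - a) ^ 2 := by
  rcases P with _ | ⟨x, y, h⟩
  · exact absurd (nsmul_zero 2) hP
  have e := curveE_equation h.1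
  have hy : y ≠ (curveE a).toAffine.negY x y := by
    intro hy
    apply hP
    rw [two_nsmul, WeierstrassCurve.Affine.Point.add_self_of_Y_eq hy]
  have hy2 : 2 * y ≠ 0 := by
    intro h0
    apply hy
    simp only [WeierstrassCurve.Affine.negY, curveE]
    linear_combination h0
  have hd : absc ((2 : ℕ) • (.some x y h : (curveE a).toAffine.Point)) =
      ((3 * x ^ 2 + a) / (2 * y)) ^ 2 - 2 * x := by
    rw [two_nsmul, WeierstrassCurve.Affine.Point.add_self_of_Y_ne hy]
    simp only [absc, WeierstrassCurve.Affine.slope_of_Y_ne rfl hy]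
    simp [WeierstrassCurve.Affine.addX, curveE, WeierstrassCurve.Affine.negY]
    ring_nf
  rw [hd]
  simp only [absc]
  constructor
  · rw [← e]
    intro h0
    exact hy2 (pow_eq_zero_iff two_ne_zero |>.1 (by linear_combination h0))
  · rw [← e]
    have hy0 : y ≠ 0 := right_ne_zero_of_mul hy2
    have h2 : (2 : K) ≠ 0 := left_ne_zero_of_mul hy2
    field_simp
    linear_combination (-32) * x * e

/-- The abscissas of the multiples of a point of infinite order form a Kummer sequence. -/
lemma isKummerSeq_absc {P : (curveE a).toAffine.Point} (hP : ¬ IsOfFinAddOrder P) :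
    IsKummerSeq a (fun k => absc (k • P)) := by
  have h0 : ∀ {k : ℕ}, 1 ≤ k → k • P ≠ 0 := fun {k} hk e =>
    hP (isOfFinAddOrder_iff_nsmul_eq_zero.2 ⟨k, hk, e⟩)
  have hne : ∀ ⦃i j : ℕ⦄, 1 ≤ j → j < i → absc (i • P) ≠ absc (j • P) := by
    intro i j hj hij e
    rcases absc_eq_imp (h0 (hj.trans hij.le)) (h0 hj) e with e | e
    · exact h0 (Nat.sub_pos_of_lt hij) (by rw [sub_nsmul _ hij.le, e, add_neg_cancel])
    · exact h0 (k := i + j) (by omega) (by rw [add_nsmul, e, neg_add_cancel])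
  refine ⟨hne, fun i j hj hij => ?_, fun i j hj hij => ?_, fun i hi => ?_, fun i hi => ?_⟩
  · have := (absc_add_sub (h0 (hj.trans hij.le)) (h0 hj) (hne hj hij)).1
    rwa [← add_nsmul, sub_eq_add_neg, ← sub_nsmul _ hij.le] at this
  · have := (absc_add_sub (h0 (hj.trans hij.le)) (h0 hj) (hne hj hij)).2
    rwa [← add_nsmul, sub_eq_add_neg, ← sub_nsmul _ hij.le] at this
  · have := (absc_two_nsmul (P := i • P) (by rw [← mul_nsmul']; exact h0 (by omega))).2
    rwa [← mul_nsmul'] at this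
  · exact (absc_two_nsmul (P := i • P) (by rw [← mul_nsmul']; exact h0 (by omega))).1

end

/-! ### Division polynomials over non-archimedean fields -/

section

lemma curveE_map {R S : Type*} [CommRing R] [CommRing S] (f : R →+* S) (a : R) :
    (curveE a).map f = curveE (f a) := by
  simp [curveE, WeierstrassCurve.map]

variable {R : Type*} [CommRing R]

lemma curveE_Ψ₂Sq (a : R) : (curveE a).Ψ₂Sq = 4 * X ^ 3 + C (4 * a) * X := by
  simp [WeierstrassCurve.Ψ₂Sq, curveE, WeierstrassCurve.b₂, WeierstrassCurve.b₄,
    WeierstrassCurve.b₆]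
  simp only [map_ofNat]
  ring

lemma curveE_Ψ₃ (a : R) : (curveE a).Ψ₃ = 3 * X ^ 4 + C (6 * a) * X ^ 2 - C (a ^ 2) := by
  simp [WeierstrassCurve.Ψ₃, curveE, WeierstrassCurve.b₂, WeierstrassCurve.b₄,
    WeierstrassCurve.b₆, WeierstrassCurve.b₈]
  simp only [map_ofNat]
  ring

lemma curveE_preΨ₄ (a : R) : (curveE a).preΨ₄ =
    2 * X ^ 6 + C (10 * a) * X ^ 4 - C (10 * a ^ 2) * X ^ 2 - C (2 * a ^ 3) := by
  simp [WeierstrassCurve.preΨ₄, curveE, WeierstrassCurve.b₂, WeierstrassCurve.b₄,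
    WeierstrassCurve.b₆, WeierstrassCurve.b₈]
  simp only [map_ofNat]
  ring

lemma curveE_ψ₂ (a : R) : (curveE a).ψ₂ = 2 * X := by
  simp [WeierstrassCurve.ψ₂, curveE, WeierstrassCurve.Affine.polynomialY]
  simp only [map_ofNat]

/-- The values of the division polynomials of `y² = x³ + a x` at `(x, y)` form the normalised
elliptic divisibility sequence; here `b = 2 y`. -/
lemma normEDS_eq_eval_preΨ' {a x b : R} (hb : b ^ 2 = 4 * (x ^ 3 + a * x)) (n : ℕ) :
    normEDS b (3 * x ^ 4 + 6 * a * x ^ 2 - a ^ 2)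
      (2 * x ^ 6 + 10 * a * x ^ 4 - 10 * a ^ 2 * x ^ 2 - 2 * a ^ 3) n =
      ((curveE a).preΨ' n).eval x * if Even n then b else 1 := by
  have hb4 : b ^ 4 = (4 * x ^ 3 + 4 * a * x) ^ 2 := by
    linear_combination (b ^ 2 + 4 * (x ^ 3 + a * x)) * hb
  rw [normEDS_ofNat, WeierstrassCurve.preΨ', ← coe_evalRingHom, map_preNormEDS', curveE_Ψ₂Sq,
    curveE_Ψ₃, curveE_preΨ₄, hb4]
  simp

end

namespace IsKummerSeq

variable {K : Type*} [Field K] {a b : K} {x : ℕ → K}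

lemma kummerW_eq_preΨ' (h : IsKummerSeq a x) (hb : b ^ 2 = 4 * (x 1 ^ 3 + a * x 1)) (n : ℕ) :
    kummerW x b n = ((curveE a).preΨ' n).eval (x 1) * if Even n then b else 1 := by
  rw [h.kummerW_eq_normEDS hb, normEDS_eq_eval_preΨ' hb]

lemma mul_kummerW_sq_eq_Φ (h : IsKummerSeq a x) (hb : b ^ 2 = 4 * (x 1 ^ 3 + a * x 1)) (n : ℕ) :
    x (n + 1) * kummerW x b (n + 1) ^ 2 = ((curveE a).Φ (n + 1 : ℕ)).eval (x 1) := by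
  rw [h.mul_kummerW_sq hb, h.kummerW_eq_preΨ' hb, h.kummerW_eq_preΨ' hb, h.kummerW_eq_preΨ' hb,
    Nat.cast_succ, WeierstrassCurve.Φ_ofNat, curveE_Ψ₂Sq]
  have hb' : b ^ 2 = 4 * x 1 ^ 3 + 4 * a * x 1 := by rw [hb]; ring
  rcases Nat.even_or_odd n with hn | hn
  · simp [hn, Nat.even_add_one]
    linear_combination eval (x 1) ((curveE a).preΨ' (n + 2)) *
      eval (x 1) ((curveE a).preΨ' n) * hb'
  · rw [← Nat.not_even_iff_odd] at hn
    simp [hn, Nat.even_add_one]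
    linear_combination x 1 * eval (x 1) ((curveE a).preΨ' (n + 1)) ^ 2 * hb'

end IsKummerSeq

section

variable (L : Type*) [NormedField L] [IsUltrametricDist L]

/-- The closed unit ball of a non-archimedean normed field, as a subring. -/
def unitBall : Subring L where
  carrier := {z | ‖z‖ ≤ 1}
  mul_mem' {y z} hy hz := by
    rw [Set.mem_ofPred, norm_mul]
    exact mul_le_one₀ hy (norm_nonneg z) hz
  one_mem' := by simp
  add_mem' {y z} hy hz := (IsUltrametricDist.norm_add_le_max y z).trans (max_le hy hz)
  zero_mem' := by simp
  neg_mem' {z} hz := by simpa using hz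

variable {L}

lemma mem_unitBall {z : L} : z ∈ unitBall L ↔ ‖z‖ ≤ 1 := Iff.rfl

lemma norm_add_lt {y z : L} {r : ℝ} (hy : ‖y‖ < r) (hz : ‖z‖ < r) : ‖y + z‖ < r :=
  (IsUltrametricDist.norm_add_le_max y z).trans_lt (max_lt hy hz)

lemma norm_sub_le_max_norm (y z : L) : ‖y - z‖ ≤ max ‖y‖ ‖z‖ := by
  simpa [sub_eq_add_neg] using IsUltrametricDist.norm_add_le_max y (-z)

lemma norm_mul_lt_one_left {L : Type*} [NormedField L] {y z : L}
    (hy : ‖y‖ < 1) (hz : ‖z‖ ≤ 1) : ‖y * z‖ < 1 := by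
  rw [norm_mul]
  exact mul_lt_one_of_nonneg_of_lt_one_left (norm_nonneg y) hy hz

lemma norm_coeff_preΨ'_le {a : L} (ha : ‖a‖ ≤ 1) (n i : ℕ) :
    ‖((curveE a).preΨ' n).coeff i‖ ≤ 1 := by
  rw [← show (unitBall L).subtype ⟨a, ha⟩ = a from rfl, ← curveE_map,
    WeierstrassCurve.map_preΨ', coeff_map]
  exact mem_unitBall.1 (SetLike.coe_mem _)

lemma norm_coeff_Φ_le {a : L} (ha : ‖a‖ ≤ 1) (n : ℤ) (i : ℕ) :
    ‖((curveE a).Φ n).coeff i‖ ≤ 1 := by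
  rw [← show (unitBall L).subtype ⟨a, ha⟩ = a from rfl, ← curveE_map,
    WeierstrassCurve.map_Φ, coeff_map]
  exact mem_unitBall.1 (SetLike.coe_mem _)

/-- The leading term dominates the value of a polynomial with integral coefficients at a point of
large norm. -/
lemma norm_eval_eq_of_one_lt {f : L[X]} (hf : ∀ i, ‖f.coeff i‖ ≤ 1) {D : ℕ} (hD : f.natDegree ≤ D)
    {z : L} (hz : 1 < ‖f.coeff D‖ * ‖z‖) : ‖f.eval z‖ = ‖f.coeff D‖ * ‖z‖ ^ D := by
  have hz1 : 1 < ‖z‖ := hz.trans_le (mul_le_of_le_one_left (norm_nonneg z) (hf D))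
  rw [eval_eq_sum_range' (Nat.lt_succ_of_le hD), Finset.sum_range_succ]
  have hlt : ‖∑ i ∈ Finset.range D, f.coeff i * z ^ i‖ < ‖f.coeff D * z ^ D‖ := by
    cases D with
    | zero =>
      simp only [Finset.range_zero, Finset.sum_empty, norm_zero, pow_zero, mul_one]
      exact pos_of_mul_pos_left (one_pos.trans hz) (norm_nonneg z)
    | succ D =>
      have h1 : ‖∑ i ∈ Finset.range (D + 1), f.coeff i * z ^ i‖ ≤ ‖z‖ ^ D := by
        refine IsUltrametricDist.norm_sum_le_of_forall_le_of_nonneg (by positivity) ?_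
        intro i hi
        rw [norm_mul, norm_pow]
        calc ‖f.coeff i‖ * ‖z‖ ^ i ≤ 1 * ‖z‖ ^ D := by
              gcongr
              · exact hf i
              · exact hz1.le
              · exact Nat.le_of_lt_succ (Finset.mem_range.1 hi)
          _ = ‖z‖ ^ D := one_mul _
      refine h1.trans_lt ?_
      rw [norm_mul, norm_pow, pow_succ', ← mul_assoc]
      exact lt_mul_of_one_lt_left (by positivity) hz
  rw [IsUltrametricDist.norm_add_eq_max_of_norm_ne_norm hlt.ne, max_eq_right hlt.le, norm_mul,
    norm_pow]

lemma norm_eval_preΨ' {a z : L} (ha : ‖a‖ ≤ 1) {l : ℕ} (hl : Odd l) (hz : 1 < ‖(l : L)‖ * ‖z‖) :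
    ‖((curveE a).preΨ' l).eval z‖ = ‖(l : L)‖ * ‖z‖ ^ ((l ^ 2 - 1) / 2) := by
  have hne : ¬ Even l := Nat.not_even_iff_odd.2 hl
  have hc := (curveE a).coeff_preΨ' l
  have hd := (curveE a).natDegree_preΨ'_le l
  rw [if_neg hne] at hc hd
  rw [if_neg hne] at hc
  rw [norm_eval_eq_of_one_lt (norm_coeff_preΨ'_le ha l) hd (by rwa [hc]), hc]

lemma norm_eval_Φ {a z : L} (ha : ‖a‖ ≤ 1) (n : ℕ) (hz : 1 < ‖z‖) :
    ‖((curveE a).Φ n).eval z‖ = ‖z‖ ^ n ^ 2 := by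
  have hc := (curveE a).coeff_Φ n
  have hd := (curveE a).natDegree_Φ_le n
  rw [Int.natAbs_natCast] at hc hd
  rw [norm_eval_eq_of_one_lt (norm_coeff_Φ_le ha n) hd (by simpa [hc] using hz), hc, norm_one,
    one_mul]

lemma norm_sq_add {a z : L} (ha : ‖a‖ ≤ 1) (hz : 1 < ‖z‖) : ‖z ^ 2 + a‖ = ‖z‖ ^ 2 := by
  have hlt : ‖a‖ < ‖z ^ 2‖ := by
    rw [norm_pow]
    exact ha.trans_lt (one_lt_pow₀ hz two_ne_zero)
  rw [IsUltrametricDist.norm_add_eq_max_of_norm_ne_norm hlt.ne', max_eq_left hlt.le, norm_pow]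

lemma norm_cube_add {a z : L} (ha : ‖a‖ ≤ 1) (hz : 1 < ‖z‖) : ‖z ^ 3 + a * z‖ = ‖z‖ ^ 3 := by
  rw [show z ^ 3 + a * z = (z ^ 2 + a) * z by ring, norm_mul, norm_sq_add ha hz]
  ring

namespace IsKummerSeq

variable {a b : L} {x : ℕ → L}

lemma norm_kummerW_le (h : IsKummerSeq a x) (hb : b ^ 2 = 4 * (x 1 ^ 3 + a * x 1))
    (ha : ‖a‖ ≤ 1) (hx : ‖x 1‖ ≤ 1) (n : ℕ) : ‖kummerW x b n‖ ≤ 1 := by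
  have hx' : x 1 ∈ unitBall L := hx
  have ha' : a ∈ unitBall L := ha
  have hb' : b ∈ unitBall L := by
    have : b ^ 2 ∈ unitBall L := by
      rw [hb]
      exact mul_mem (natCast_mem _ 4) (add_mem (pow_mem hx' 3) (mul_mem ha' hx'))
    rw [mem_unitBall, norm_pow] at this
    exact (pow_le_one_iff_of_nonneg (norm_nonneg b) two_ne_zero).1 this
  rw [h.kummerW_eq_normEDS hb, ← show (unitBall L).subtype ⟨b, hb'⟩ = b from rfl,
    ← show (unitBall L).subtype ⟨a, ha'⟩ = a from rfl,
    ← show (unitBall L).subtype ⟨x 1, hx'⟩ = x 1 from rfl]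
  have := map_normEDS (b := (⟨b, hb'⟩ : unitBall L))
    (c := 3 * ⟨x 1, hx'⟩ ^ 4 + 6 * ⟨a, ha'⟩ * ⟨x 1, hx'⟩ ^ 2 - ⟨a, ha'⟩ ^ 2)
    (d := 2 * ⟨x 1, hx'⟩ ^ 6 + 10 * ⟨a, ha'⟩ * ⟨x 1, hx'⟩ ^ 4 - 10 * ⟨a, ha'⟩ ^ 2 * ⟨x 1, hx'⟩ ^ 2
      - 2 * ⟨a, ha'⟩ ^ 3) (unitBall L).subtype n
  simp only [map_add, map_sub, map_mul, map_pow, map_ofNat] at this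
  rw [← this]
  exact mem_unitBall.1 (SetLike.coe_mem _)

lemma norm_mul_kummerW_sq_le (h : IsKummerSeq a x) (hb : b ^ 2 = 4 * (x 1 ^ 3 + a * x 1))
    (ha : ‖a‖ ≤ 1) (hx : ‖x 1‖ ≤ 1) {n : ℕ} (hn : 1 ≤ n) : ‖x n * kummerW x b n ^ 2‖ ≤ 1 := by
  obtain ⟨n, rfl⟩ := Nat.exists_eq_add_of_le' hn
  rw [h.mul_kummerW_sq hb]
  have hW := fun k => mem_unitBall.2 (h.norm_kummerW_le hb ha hx k)
  exact sub_mem (mul_mem (mem_unitBall.2 hx) (pow_mem (hW _) 2)) (mul_mem (hW _) (hW _))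

/-- If the reduction of the point is nonsingular, then no two consecutive terms of its elliptic
sequence vanish in the residue field: otherwise `P` and `m P` would have the same abscissa there
for some `m` for which `(m + 1) P` is at infinity, which forces a singular reduction. -/
lemma not_norm_kummerW_lt_one (h : IsKummerSeq a x) (hb : b ^ 2 = 4 * (x 1 ^ 3 + a * x 1))
    (ha : ‖a‖ ≤ 1) (hx : ‖x 1‖ ≤ 1) (hns : ¬ (‖x 1 ^ 2 - a‖ < 1 ∧ ‖b‖ < 1)) (n : ℕ) :
    ¬ (‖kummerW x b (n + 1)‖ < 1 ∧ ‖kummerW x b (n + 2)‖ < 1) := by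
  have hW := h.norm_kummerW_le hb ha hx
  induction n with
  | zero =>
    rintro ⟨h1, -⟩
    simp [kummerW] at h1
  | succ s ih =>
    rintro ⟨h2, h3⟩
    have h1 : ‖kummerW x b (s + 1)‖ = 1 := by
      refine le_antisymm (hW _) (not_lt.1 fun h1 => ih ⟨h1, h2⟩)
    apply hns
    have hφ : ‖x (s + 2) * kummerW x b (s + 2) ^ 2‖ < 1 := by
      rw [h.mul_kummerW_sq hb (s + 1), sub_eq_add_neg, sq, mul_left_comm]
      refine norm_add_lt (norm_mul_lt_one_left h2 ?_) ?_
      · rw [norm_mul]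
        exact mul_le_one₀ hx (norm_nonneg _) (hW _)
      · rw [norm_neg]
        exact norm_mul_lt_one_left h3 (hW _)
    cases s with
    | zero =>
      have hb2 : kummerW x b 2 = b := by simp [kummerW]
      rw [hb2] at h2 hφ
      refine ⟨?_, h2⟩
      rw [hb, h.dup le_rfl, norm_pow] at hφ
      exact (pow_lt_one_iff_of_nonneg (norm_nonneg _) two_ne_zero).1 hφ
    | succ s =>
      have hm := h.mul (i := s + 2) (j := 1) le_rfl (by omega)
      have hA := h.add (i := s + 2) (j := 1) le_rfl (by omega)
      have st := h.kummerW_step hb (s + 1)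
      have hψ := h.norm_mul_kummerW_sq_le hb ha hx (n := s + 1) (by omega)
      rw [show s + 2 - 1 = s + 1 by omega] at hm hA
      simp only [show s + 1 + 2 = s + 3 from rfl, show s + 1 + 1 = s + 2 from rfl] at *
      -- the abscissas `x (s + 2)` and `x 1` agree in the residue field
      have hδ : ‖x 1 - x (s + 2)‖ < 1 := by
        have := norm_mul_lt_one_left h2 (hW (s + 1))
        rwa [st, norm_mul, norm_pow, h1, one_pow, mul_one] at this
      have h1' : ‖kummerW x b (s + 2) ^ 4‖ = 1 := by rw [norm_pow, h1, one_pow]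
      have hx2 : x 1 ∈ unitBall L := hx
      have hδ' : x 1 - x (s + 2) ∈ unitBall L := hδ.le
      have ha' : a ∈ unitBall L := ha
      -- the product formula
      have hmul : ‖x (s + 2) * x 1 - a‖ < 1 := by
        have e : (x (s + 3) * kummerW x b (s + 3) ^ 2) * (x (s + 1) * kummerW x b (s + 1) ^ 2) =
            (x (s + 2) * x 1 - a) ^ 2 * kummerW x b (s + 2) ^ 4 := by
          rw [← hm]
          linear_combination x (s + 3) * x (s + 1) * (kummerW x b (s + 3) * kummerW x b (s + 1) +
            (x 1 - x (s + 2)) * kummerW x b (s + 2) ^ 2) * st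
        have := norm_mul_lt_one_left hφ hψ
        rw [e, norm_mul, h1', mul_one, norm_pow] at this
        exact (pow_lt_one_iff_of_nonneg (norm_nonneg _) two_ne_zero).1 this
      -- the sum formula
      have hadd : ‖2 * (x (s + 2) + x 1) * (x (s + 2) * x 1 + a)‖ < 1 := by
        have e : (x (s + 3) * kummerW x b (s + 3) ^ 2) * kummerW x b (s + 1) ^ 2 +
            kummerW x b (s + 3) * (kummerW x b (s + 3) * (x (s + 1) * kummerW x b (s + 1) ^ 2)) =
            2 * (x (s + 2) + x 1) * (x (s + 2) * x 1 + a) * kummerW x b (s + 2) ^ 4 := by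
          rw [← hA]
          linear_combination (x (s + 3) + x (s + 1)) * (kummerW x b (s + 3) * kummerW x b (s + 1) +
            (x 1 - x (s + 2)) * kummerW x b (s + 2) ^ 2) * st
        have := norm_add_lt
          (norm_mul_lt_one_left hφ (z := kummerW x b (s + 1) ^ 2) ?_)
          (norm_mul_lt_one_left h2
            (z := kummerW x b (s + 3) * (x (s + 1) * kummerW x b (s + 1) ^ 2)) ?_)
        · rwa [e, norm_mul, h1', mul_one] at this
        · rw [norm_pow]
          exact pow_le_one₀ (norm_nonneg _) (hW _)
        · rw [norm_mul]
          exact mul_le_one₀ (hW _) (norm_nonneg _) hψ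
      constructor
      · rw [show x 1 ^ 2 - a = x (s + 2) * x 1 - a + (x 1 - x (s + 2)) * x 1 by ring]
        exact norm_add_lt hmul (norm_mul_lt_one_left hδ hx)
      · have : ‖b ^ 2‖ < 1 := by
          rw [hb, show 4 * (x 1 ^ 3 + a * x 1) =
            2 * (x (s + 2) + x 1) * (x (s + 2) * x 1 + a) + (x 1 - x (s + 2)) *
              (2 * (x 1 ^ 2 + a) + 2 * (2 * x 1 - (x 1 - x (s + 2))) * x 1) by ring]
          refine norm_add_lt hadd (norm_mul_lt_one_left hδ ?_)
          have two_mem : (2 : L) ∈ unitBall L := natCast_mem _ 2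
          exact add_mem (mul_mem two_mem (add_mem (pow_mem hx2 2) ha'))
            (mul_mem (mul_mem two_mem (sub_mem (mul_mem two_mem hx2) hδ')) hx2)
        rw [norm_pow] at this
        exact (pow_lt_one_iff_of_nonneg (norm_nonneg _) two_ne_zero).1 this

lemma not_norm_lt_one (h : IsKummerSeq a x) (hb : b ^ 2 = 4 * (x 1 ^ 3 + a * x 1))
    (ha : ‖a‖ ≤ 1) (hx : ‖x 1‖ ≤ 1) (hns : ¬ (‖x 1 ^ 2 - a‖ < 1 ∧ ‖b‖ < 1)) {n : ℕ} (hn : 1 ≤ n) :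
    ¬ (‖x n * kummerW x b n ^ 2‖ < 1 ∧ ‖kummerW x b n‖ < 1) := by
  obtain ⟨n, rfl⟩ := Nat.exists_eq_add_of_le' hn
  rintro ⟨h1, h2⟩
  have hW := h.norm_kummerW_le hb ha hx
  have h3 : ‖kummerW x b (n + 2) * kummerW x b n‖ < 1 := by
    rw [← sub_sub_cancel (x 1 * kummerW x b (n + 1) ^ 2) (kummerW x b (n + 2) * kummerW x b n),
      ← h.mul_kummerW_sq hb, sub_eq_add_neg, sq, mul_left_comm]
    refine norm_add_lt (norm_mul_lt_one_left h2 ?_) (by rwa [norm_neg, ← sq])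
    rw [norm_mul]
    exact mul_le_one₀ hx (norm_nonneg _) (hW _)
  have h4 : 1 ≤ ‖kummerW x b (n + 2)‖ :=
    not_lt.1 fun h4 => h.not_norm_kummerW_lt_one hb ha hx hns n ⟨h2, h4⟩
  have h5 : ‖kummerW x b n‖ < 1 := by
    refine lt_of_le_of_lt ?_ h3
    rw [norm_mul]
    exact le_mul_of_one_le_left (norm_nonneg _) h4
  cases n with
  | zero => simp [kummerW] at h2
  | succ n => exact h.not_norm_kummerW_lt_one hb ha hx hns n ⟨h5, h2⟩

end IsKummerSeq

end

/-! ### Specialization of polynomials in `ℤ[a][x][y]` -/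

section

variable {L : Type*} [NormedField L] [IsUltrametricDist L] [DecidableEq L]

/-- Where `2` is small, a point reducing to infinity has infinite order, since doubling it brings it
closer to infinity. -/
lemma not_isOfFinAddOrder_of_one_lt {a : L} (ha : ‖a‖ ≤ 1) (h2 : ‖(2 : L)‖ < 1) (h20 : (2 : L) ≠ 0)
    {P : (curveE a).toAffine.Point} (hP0 : P ≠ 0) (hP : 1 < ‖absc P‖) : ¬ IsOfFinAddOrder P := by
  have step : ∀ Q : (curveE a).toAffine.Point, Q ≠ 0 → 1 < ‖absc Q‖ →
      (2 : ℕ) • Q ≠ 0 ∧ ‖absc Q‖ < ‖absc ((2 : ℕ) • Q)‖ := by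
    intro Q hQ hx
    have hsub : ‖absc Q ^ 2 - a‖ = ‖absc Q‖ ^ 2 := by
      rw [sub_eq_add_neg, norm_sq_add (by rwa [norm_neg]) hx]
    have hcub := norm_cube_add ha hx
    have hne : (2 : ℕ) • Q ≠ 0 := by
      intro h0
      rcases Q with _ | ⟨x, y, h⟩
      · exact hQ rfl
      have hQQ : (.some x y h : (curveE a).toAffine.Point) = -.some x y h := by
        rw [two_nsmul] at h0
        exact eq_neg_of_add_eq_zero_left h0
      rw [WeierstrassCurve.Affine.Point.neg_some] at hQQ
      injection hQQ with _ hy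
      have e := curveE_equation h.1
      have hy0 : y = 0 := by
        simp only [WeierstrassCurve.Affine.negY, curveE] at hy
        refine (mul_eq_zero.1 (?_ : 2 * y = 0)).resolve_left h20
        linear_combination hy
      have hcub' : ‖x ^ 3 + a * x‖ = ‖x‖ ^ 3 := hcub
      rw [← e, hy0] at hcub'
      have : 0 < ‖x‖ := one_pos.trans hx
      have : 0 < ‖x‖ ^ 3 := by positivity
      simp [← hcub'] at this
    refine ⟨hne, ?_⟩
    have hd := congrArg norm (absc_two_nsmul hne).2
    rw [norm_mul, norm_mul, hcub, norm_pow, hsub] at hd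
    have h4 : ‖(4 : L)‖ < 1 := by
      rw [show (4 : L) = 2 * 2 by norm_num]
      exact norm_mul_lt_one_left h2 h2.le
    have hx0 : 0 < ‖absc Q‖ := one_pos.trans hx
    have e : ‖absc ((2 : ℕ) • Q)‖ * ‖(4 : L)‖ = ‖absc Q‖ := by
      refine mul_right_cancel₀ (pow_pos hx0 3).ne' ?_
      linear_combination hd
    rw [← e]
    refine mul_lt_of_lt_one_right (pos_of_mul_pos_left (e ▸ hx0) (norm_nonneg _)) h4
  have all : ∀ k : ℕ, (2 ^ k) • P ≠ 0 ∧ 1 < ‖absc ((2 ^ k) • P)‖ := by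
    intro k
    induction k with
    | zero => simpa using ⟨hP0, hP⟩
    | succ k ih =>
      have := step _ ih.1 ih.2
      rw [pow_succ', mul_nsmul']
      exact ⟨this.1, ih.2.trans this.2⟩
  have mono : StrictMono fun k : ℕ => ‖absc ((2 ^ k) • P)‖ := by
    refine strictMono_nat_of_lt_succ fun k => ?_
    have := (step _ (all k).1 (all k).2).2
    rwa [← mul_nsmul', ← pow_succ'] at this
  intro hfin
  have hinj : Function.Injective fun k : ℕ => (2 ^ k) • P := fun i j hij =>
    mono.injective (congrArg (fun Q => ‖absc Q‖) hij)
  exact Set.infinite_of_injective_forall_mem hinj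
    (fun k => (AddSubmonoid.mem_multiples_iff _ _).2 ⟨2 ^ k, rfl⟩) (finite_multiples.2 hfin)

end

section

variable {R : Type*} [CommRing R]

/-- The substitution of elements of a ring for `a` and `x` in an element of `ℤ[a][x]`. -/
noncomputable def spec (a x : R) : ℤ[X][X] →+* R :=
  eval₂RingHom (eval₂RingHom (Int.castRingHom R) a) x

/-- The substitution of elements of a ring for `a`, `x` and `y` in an element of `ℤ[a][x][y]`. -/
noncomputable def spec₃ (a x y : R) : ℤ[X][X][X] →+* R :=
  eval₂RingHom (spec a x) y

lemma spec₃_C (a x y : R) (f : ℤ[X][X]) : spec₃ a x y (C f) = spec a x f := by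
  simp [spec₃]

lemma spec_eq_eval (a x : R) (f : ℤ[X][X]) :
    spec a x f = (f.map (eval₂RingHom (Int.castRingHom R) a)).eval x := by
  simp [spec, eval_map]

lemma curveE_map_X (a : R) :
    (curveE (X : ℤ[X])).map (eval₂RingHom (Int.castRingHom R) a) = curveE a := by
  rw [curveE_map]; simp

lemma spec_preΨ' (a x : R) (n : ℕ) :
    spec a x ((curveE (X : ℤ[X])).preΨ' n) = ((curveE a).preΨ' n).eval x := by
  rw [spec_eq_eval, ← WeierstrassCurve.map_preΨ', curveE_map_X]

lemma spec_Φ (a x : R) (n : ℤ) :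
    spec a x ((curveE (X : ℤ[X])).Φ n) = ((curveE a).Φ n).eval x := by
  rw [spec_eq_eval, ← WeierstrassCurve.map_Φ, curveE_map_X]

lemma spec_ΨSq (a x : R) (n : ℤ) :
    spec a x ((curveE (X : ℤ[X])).ΨSq n) = ((curveE a).ΨSq n).eval x := by
  rw [spec_eq_eval, ← WeierstrassCurve.map_ΨSq, curveE_map_X]

lemma divPoly_eq (n : ℕ) :
    divPoly n = C ((curveE (X : ℤ[X])).preΨ' n) * if Even n then 2 * X else 1 := by
  rw [divPoly, WeierstrassCurve.Ψ_ofNat, curveE_ψ₂]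

lemma spec₃_divPoly (a x y : R) (n : ℕ) :
    spec₃ a x y (divPoly n) = ((curveE a).preΨ' n).eval x * if Even n then 2 * y else 1 := by
  rw [divPoly_eq, map_mul, spec₃_C, spec_preΨ']
  split_ifs <;> simp [spec₃]

lemma norm_ratCast_padicAlgCl (p : ℕ) [Fact p.Prime] (q : ℚ) :
    ‖(q : PadicAlgCl p)‖ = ‖(q : ℚ_[p])‖ := by
  rw [← PadicAlgCl.norm_extends, map_ratCast]

lemma norm_intCast_padicAlgCl (p : ℕ) [Fact p.Prime] (z : ℤ) :
    ‖(z : PadicAlgCl p)‖ = ‖(z : ℚ_[p])‖ := by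
  simpa using norm_ratCast_padicAlgCl p z

lemma norm_natCast_padicAlgCl (p : ℕ) [Fact p.Prime] (k : ℕ) :
    ‖(k : PadicAlgCl p)‖ = ‖(k : ℚ_[p])‖ := by
  simpa using norm_ratCast_padicAlgCl p k

lemma norm_two_padicAlgCl : ‖(2 : PadicAlgCl 2)‖ = 2⁻¹ := by
  rw [show (2 : PadicAlgCl 2) = ((2 : ℕ) : PadicAlgCl 2) by simp, norm_natCast_padicAlgCl,
    Padic.norm_p]
  simp

/-- Polynomials in `ℤ[a][x]` are determined by their values at `(a, x)`, for `a` an integer and `x`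
of large `2`-adic norm. -/
lemma eq_zero_of_spec_eq_zero {f : ℤ[X][X]}
    (h : ∀ (a : ℤ) (x : PadicAlgCl 2), 1 < ‖x‖ → spec (a : PadicAlgCl 2) x f = 0) : f = 0 := by
  have h1 : ∀ a : ℤ,
      f.map (eval₂RingHom (Int.castRingHom (PadicAlgCl 2)) (a : PadicAlgCl 2)) = 0 := by
    intro a
    have hnorm : ‖(2 : PadicAlgCl 2)⁻¹‖ = 2 := by rw [norm_inv, norm_two_padicAlgCl, inv_inv]
    refine eq_zero_of_infinite_isRoot _ (Set.infinite_of_injective_forall_mem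
      (f := fun k : ℕ => ((2 : PadicAlgCl 2)⁻¹) ^ (k + 1)) ?_ ?_)
    · intro i j hij
      have := congrArg norm hij
      simp only [norm_pow, hnorm] at this
      have := pow_right_injective₀ two_pos (by norm_num : (2 : ℝ) ≠ 1) this
      omega
    · intro k
      rw [Set.mem_ofPred, IsRoot, ← spec_eq_eval]
      refine h a _ ?_
      rw [norm_pow, hnorm]
      exact one_lt_pow₀ one_lt_two k.succ_ne_zero
  ext i : 1
  refine Polynomial.funext fun a => ?_
  have := congrArg (fun g => g.coeff i) (h1 a)
  simp only [coeff_map, coeff_zero, coe_eval₂RingHom] at this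
  rw [coeff_zero, eval_zero]
  have h3 : ((eval a (f.coeff i) : ℤ) : PadicAlgCl 2) = 0 := by
    rw [← this, ← eq_intCast (Int.castRingHom (PadicAlgCl 2)) a, eval₂_at_apply]
    simp
  exact_mod_cast h3

end

/-! ### Divisibility of division polynomials -/

section

/-- The homogenization of `preΨ' l`, of degree `(l² - 1) / 2`, evaluated at the numerator `Φ k` and
the denominator `ΨSq k` of the abscissa of `k` times a point. -/
noncomputable def homogPsi {R : Type*} [CommRing R] (W : WeierstrassCurve R) (l k : ℕ) : R[X] :=
  ∑ j ∈ Finset.range ((l ^ 2 - 1) / 2 + 1),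
    C ((W.preΨ' l).coeff j) * W.Φ k ^ j * W.ΨSq k ^ ((l ^ 2 - 1) / 2 - j)

lemma spec_homogPsi {R : Type*} [CommRing R] (a x : R) (l k : ℕ) :
    spec a x (homogPsi (curveE (X : ℤ[X])) l k) = (homogPsi (curveE a) l k).eval x := by
  have hc : ∀ j, spec a x (C (((curveE (X : ℤ[X])).preΨ' l).coeff j)) =
      ((curveE a).preΨ' l).coeff j := by
    intro j
    conv_rhs => rw [← curveE_map_X, WeierstrassCurve.map_preΨ', coeff_map]
    simp [spec]
  simp only [homogPsi, map_sum, map_mul, map_pow, spec_Φ, spec_ΨSq, hc, eval_finsetSum, eval_mul,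
    eval_pow, eval_C]

namespace IsKummerSeq

variable {K : Type*} [Field K] {a b : K} {x : ℕ → K}

lemma kummerW_mul_odd (h : IsKummerSeq a x) (hb : b ^ 2 = 4 * (x 1 ^ 3 + a * x 1)) {k l : ℕ}
    (hk : 1 ≤ k) (hl : Odd l) :
    kummerW x b (k * l) = ((curveE a).preΨ' l).eval (x k) * kummerW x b k ^ l ^ 2 := by
  obtain ⟨b', hb', hW⟩ := h.exists_kummerW_mul hb hk
  rw [hW, (h.subseq hk).kummerW_eq_preΨ' (by simpa using hb'),
    if_neg (Nat.not_even_iff_odd.2 hl), mul_one, mul_one]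

lemma eval_homogPsi (h : IsKummerSeq a x) (hb : b ^ 2 = 4 * (x 1 ^ 3 + a * x 1)) {k l : ℕ}
    (hk : 1 ≤ k) (hl : Odd l) :
    ((curveE a).preΨ' (k * l)).eval (x 1) =
      ((curveE a).preΨ' k).eval (x 1) * (homogPsi (curveE a) l k).eval (x 1) := by
  have hW := h.kummerW_mul_odd hb hk hl
  have hb0 : b ≠ 0 := by
    rintro rfl
    exact h.dup_ne le_rfl (by rw [← hb]; ring)
  have hSq : kummerW x b k ^ 2 = ((curveE a).ΨSq k).eval (x 1) := by
    rw [h.kummerW_eq_preΨ' hb, WeierstrassCurve.ΨSq_ofNat, curveE_Ψ₂Sq, mul_pow]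
    split_ifs
    · simp [hb]; left; ring
    · simp
  have hΦ : x k * kummerW x b k ^ 2 = ((curveE a).Φ k).eval (x 1) := by
    obtain ⟨k, rfl⟩ := Nat.exists_eq_add_of_le' hk
    exact h.mul_kummerW_sq_eq_Φ hb k
  obtain ⟨D, hD⟩ : ∃ D, l ^ 2 = 2 * D + 1 := hl.pow
  have hD' : (l ^ 2 - 1) / 2 = D := by omega
  have hdeg : ((curveE a).preΨ' l).natDegree < D + 1 := by
    have := (curveE a).natDegree_preΨ'_le l
    rw [if_neg (Nat.not_even_iff_odd.2 hl), hD'] at this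
    omega
  have key : ((curveE a).preΨ' l).eval (x k) * kummerW x b k ^ l ^ 2 =
      kummerW x b k * (homogPsi (curveE a) l k).eval (x 1) := by
    rw [eval_eq_sum_range' hdeg, homogPsi, hD', eval_finsetSum, Finset.sum_mul, Finset.mul_sum]
    refine Finset.sum_congr rfl fun j hj => ?_
    have hjD : j ≤ D := Nat.lt_succ_iff.1 (Finset.mem_range.1 hj)
    rw [eval_mul, eval_mul, eval_pow, eval_pow, eval_C, ← hΦ, ← hSq, hD,
      show 2 * D + 1 = 1 + 2 * j + 2 * (D - j) by omega]
    ring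
  rw [key, h.kummerW_eq_preΨ' hb, h.kummerW_eq_preΨ' hb] at hW
  have hpar : Even (k * l) ↔ Even k := by
    simp [Nat.even_mul, Nat.not_even_iff_odd.2 hl]
  simp only [hpar] at hW
  split_ifs at hW
  · refine mul_right_cancel₀ hb0 ?_
    linear_combination hW
  · linear_combination hW

end IsKummerSeq

/-- The composition formula `ψ_{k l} = ψ_k · (homogenized ψ_l at (φ_k, ψ_k²))` for odd `l`, as an
identity of polynomials with the coefficient of the curve as an indeterminate. It holds at points of
infinite order, and there are enough of them over `PadicAlgCl 2`. -/
lemma preΨ'_mul_odd {k l : ℕ} (hk : 1 ≤ k) (hl : Odd l) :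
    (curveE (X : ℤ[X])).preΨ' (k * l) =
      (curveE (X : ℤ[X])).preΨ' k * homogPsi (curveE (X : ℤ[X])) l k := by
  classical
  rw [← sub_eq_zero]
  refine eq_zero_of_spec_eq_zero fun a x hx => ?_
  have ha : ‖(a : PadicAlgCl 2)‖ ≤ 1 := IsUltrametricDist.norm_intCast_le_one _ a
  obtain ⟨y, hy⟩ := IsAlgClosed.exists_pow_nat_eq (x ^ 3 + a * x) two_pos
  have h2 : ‖(2 : PadicAlgCl 2)‖ < 1 := by rw [norm_two_padicAlgCl]; norm_num
  have hne : x ^ 3 + a * x ≠ 0 := by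
    intro h0
    have := norm_cube_add ha hx
    rw [h0, norm_zero] at this
    exact (pow_pos (one_pos.trans hx) 3).ne this
  have hns : (curveE (a : PadicAlgCl 2)).toAffine.Nonsingular x y := by
    rw [WeierstrassCurve.Affine.nonsingular_iff, WeierstrassCurve.Affine.equation_iff]
    refine ⟨by simpa [curveE] using hy, Or.inr ?_⟩
    intro hyy
    have hy0 : 2 * y = 0 := by
      simp [curveE] at hyy
      linear_combination hyy
    rw [← hy, (mul_eq_zero.1 hy0).resolve_left two_ne_zero] at hne
    simp at hne
  have hK := isKummerSeq_absc (not_isOfFinAddOrder_of_one_lt ha h2 two_ne_zero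
    (WeierstrassCurve.Affine.Point.some_ne_zero hns) hx)
  have := hK.eval_homogPsi (b := 2 * y) (by simp [absc]; linear_combination 4 * hy) hk hl
  rw [map_sub, map_mul, spec_preΨ', spec_preΨ', spec_homogPsi, sub_eq_zero]
  simpa [absc] using this

lemma divPoly_dvd_of_prime {n l : ℕ} (hn : Squarefree n) (hl : l.Prime) (hln : l ∣ n) :
    divPoly (n / l) ∣ divPoly n := by
  obtain ⟨k, rfl⟩ := hln
  have hk : 1 ≤ k := Nat.pos_of_ne_zero (by rintro rfl; simp at hn)
  rw [Nat.mul_div_cancel_left _ hl.pos]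
  rcases hl.eq_two_or_odd' with rfl | hodd
  · have hkodd : ¬ Even k := by
      rintro ⟨m, rfl⟩
      have := hn 2 ⟨m, by ring⟩
      exact absurd (Nat.isUnit_iff.1 this) (by norm_num)
    have := (curveE (X : ℤ[X])).preΨ_even k
    rw [show (2 : ℤ) * k = (2 * k : ℕ) by simp, WeierstrassCurve.preΨ_ofNat] at this
    rw [divPoly_eq, divPoly_eq, if_neg hkodd, mul_one, this]
    refine Dvd.dvd.mul_right (_root_.map_dvd C ?_) _
    rw [← WeierstrassCurve.preΨ_ofNat]
    exact dvd_sub ((dvd_mul_left _ _).mul_right _) ((dvd_mul_left _ _).mul_right _)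
  · have hpar : Even (k * l) ↔ Even k := by
      simp [Nat.even_mul, Nat.not_even_iff_odd.2 hodd]
    rw [mul_comm, divPoly_eq, divPoly_eq, preΨ'_mul_odd hk hodd]
    simp only [hpar]
    exact mul_dvd_mul_right (_root_.map_dvd C (dvd_mul_right _ _)) _

lemma divPoly_ne_zero {n : ℕ} (hn : n ≠ 0) : divPoly n ≠ 0 := by
  rw [divPoly_eq]
  refine mul_ne_zero (C_ne_zero.2 ((curveE _).preΨ'_ne_zero (Nat.cast_ne_zero.2 hn))) ?_
  split_ifs
  · exact mul_ne_zero two_ne_zero X_ne_zero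
  · exact one_ne_zero

lemma natDegree_divPoly {n : ℕ} (hn : n ≠ 0) :
    (divPoly n).natDegree = if Even n then 1 else 0 := by
  have h0 : (curveE (X : ℤ[X])).preΨ' n ≠ 0 := (curveE _).preΨ'_ne_zero (Nat.cast_ne_zero.2 hn)
  rw [divPoly_eq, natDegree_C_mul h0]
  split_ifs
  · rw [show (2 : ℤ[X][X][X]) = C 2 from (map_ofNat C 2).symm, natDegree_C_mul two_ne_zero,
      natDegree_X]
  · simp

/-- The values at `x = 0` of the division polynomials of `y² = x³ + x`. -/
lemma preNormEDS'_zero_neg_one_neg_two (n : ℕ) :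
    (∀ t, n = 2 * t + 1 → preNormEDS' (0 : ℤ) (-1) (-2) n = (-1) ^ t) ∧
      (∀ t, n = 2 * t → preNormEDS' (0 : ℤ) (-1) (-2) n = (-1) ^ (t + 1) * t) := by
  induction n using normEDSRec with
  | zero => exact ⟨fun t ht => by omega, fun t ht => by simp [show t = 0 by omega]⟩
  | one => exact ⟨fun t ht => by simp [show t = 0 by omega], fun t ht => by omega⟩
  | two => exact ⟨fun t ht => by omega, fun t ht => by simp [show t = 1 by omega]⟩
  | three => exact ⟨fun t ht => by simp [show t = 1 by omega], fun t ht => by omega⟩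
  | four => exact ⟨fun t ht => by omega, fun t ht => by simp [show t = 2 by omega]⟩
  | even m h1 h2 h3 h4 h5 =>
    refine ⟨fun t ht => by omega, fun t ht => ?_⟩
    obtain rfl : t = m + 3 := by omega
    rw [preNormEDS'_even]
    obtain ⟨s, rfl | rfl⟩ := Nat.even_or_odd' m
    · rw [h1.1 s rfl, h2.2 (s + 1) (by ring), h3.1 (s + 1) (by ring), h4.2 (s + 2) (by ring),
        h5.1 (s + 2) (by ring)]
      push_cast
      rcases neg_one_pow_eq_or ℤ s with h | h <;> simp only [pow_add, pow_mul, h] <;> ring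
    · rw [h1.2 (s + 1) (by ring), h2.1 (s + 1) (by ring), h3.2 (s + 2) (by ring),
        h4.1 (s + 2) (by ring), h5.2 (s + 3) (by ring)]
      push_cast
      rcases neg_one_pow_eq_or ℤ s with h | h <;> simp only [pow_add, pow_mul, h] <;> ring
  | odd m h1 h2 h3 h4 =>
    refine ⟨fun t ht => ?_, fun t ht => by omega⟩
    obtain rfl : t = m + 2 := by omega
    rw [preNormEDS'_odd]
    obtain ⟨s, rfl | rfl⟩ := Nat.even_or_odd' m
    · rw [h1.1 s rfl, h3.1 (s + 1) (by ring)]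
      rcases neg_one_pow_eq_or ℤ s with h | h <;> simp [pow_add, pow_mul, h]
    · rw [h2.1 (s + 1) (by ring), h4.1 (s + 2) (by ring)]
      rcases neg_one_pow_eq_or ℤ s with h | h <;>
        simp [pow_add, pow_mul, h]

lemma spec_one_zero_preΨ'_ne_zero {n : ℕ} (hn : n ≠ 0) :
    spec (1 : ℤ) 0 ((curveE (X : ℤ[X])).preΨ' n) ≠ 0 := by
  rw [spec_preΨ', WeierstrassCurve.preΨ', ← coe_evalRingHom, map_preNormEDS', curveE_Ψ₂Sq,
    curveE_Ψ₃, curveE_preΨ₄]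
  have := preNormEDS'_zero_neg_one_neg_two n
  simp
  obtain ⟨t, rfl | rfl⟩ := Nat.even_or_odd' n
  · rw [this.2 t rfl]
    exact mul_ne_zero (by simp) (by exact_mod_cast fun h0 => hn (by simp [h0]))
  · rw [this.1 t rfl]
    simp

end

/-! ### The polynomial `Ψ_n` -/

section

lemma exactQuot_mul {R : Type*} [CommRing R] {f g : R} (h : g ∣ f) : exactQuot f g * g = f := by
  rw [exactQuot, dif_pos h, mul_comm]
  exact h.choose_spec.symm

lemma divPolyLcm_dvd {n : ℕ} (hn : Squarefree n) : divPolyLcm n ∣ divPoly n :=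
  Finset.lcm_dvd fun _ hl => divPoly_dvd_of_prime hn (Nat.prime_of_mem_primeFactors hl)
    (Nat.dvd_of_mem_primeFactors hl)

lemma divPoly_dvd_divPolyLcm {n l : ℕ} (hl : l ∈ n.primeFactors) :
    divPoly (n / l) ∣ divPolyLcm n :=
  Finset.dvd_lcm (f := fun l => divPoly (n / l)) hl

/-- The quotient `ψ_n / lcm ψ_{n/l}` does not involve `y`: for even `n > 2` some `n / l` is even,
so that `y` divides the least common multiple. -/
lemma C_primPsi_mul {n : ℕ} (hn : 3 ≤ n) (hsq : Squarefree n) :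
    C (primPsi n) * divPolyLcm n = divPoly n := by
  have h := exactQuot_mul (divPolyLcm_dvd hsq)
  have h0 := divPoly_ne_zero (n := n) (by omega)
  have hq0 : exactQuot (divPoly n) (divPolyLcm n) ≠ 0 := by
    intro e; rw [e, zero_mul] at h; exact h0 h.symm
  have hl0 : divPolyLcm n ≠ 0 := by
    intro e; rw [e, mul_zero] at h; exact h0 h.symm
  have hdeg := congrArg natDegree h
  rw [natDegree_mul hq0 hl0, natDegree_divPoly (by omega)] at hdeg
  have hq : (exactQuot (divPoly n) (divPolyLcm n)).natDegree = 0 := by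
    split_ifs at hdeg with he
    · obtain ⟨m, rfl⟩ := he.two_dvd
      have hm2 : ¬ 2 ∣ m := fun ⟨k, hk⟩ => by
        have := hsq 2 ⟨k, by rw [hk]; ring⟩
        exact absurd (Nat.isUnit_iff.1 this) (by norm_num)
      have hl := Nat.minFac_prime (n := m) (by omega)
      have hlm := Nat.minFac_dvd m
      have hmem : m.minFac ∈ (2 * m).primeFactors :=
        Nat.mem_primeFactors.2 ⟨hl, hlm.mul_left 2, by omega⟩
      have h1 := natDegree_le_of_dvd (divPoly_dvd_divPolyLcm hmem) hl0
      have hpos : 0 < m / m.minFac := Nat.div_pos (Nat.minFac_le (by omega)) hl.pos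
      rw [Nat.mul_div_assoc _ hlm, natDegree_divPoly (by omega), if_pos (even_two_mul _)] at h1
      omega
    · omega
  rw [primPsi, ← eq_C_of_natDegree_eq_zero hq]
  exact h

/-- The substitution `x ↦ -x` in `ℤ[a][x][y]`. -/
noncomputable def negX : ℤ[X][X][X] →+* ℤ[X][X][X] :=
  mapRingHom (compRingHom (-X))

lemma negX_negX (f : ℤ[X][X][X]) : negX (negX f) = f := by
  ext i : 1
  simp [negX, comp_assoc]

lemma preΨ'_comp_neg (n : ℕ) :
    ((curveE (X : ℤ[X])).preΨ' n).comp (-X) = (curveE (X : ℤ[X])).preΨ' n := by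
  have e₂ : compRingHom (-X) ((curveE (X : ℤ[X])).Ψ₂Sq ^ 2) = (curveE (X : ℤ[X])).Ψ₂Sq ^ 2 := by
    rw [map_pow, curveE_Ψ₂Sq, coe_compRingHom_apply, ← neg_sq]
    congr 1
    simp
    ring
  have e₃ : compRingHom (-X) (curveE (X : ℤ[X])).Ψ₃ = (curveE (X : ℤ[X])).Ψ₃ := by
    rw [curveE_Ψ₃, coe_compRingHom_apply]
    simp
    ring
  have e₄ : compRingHom (-X) (curveE (X : ℤ[X])).preΨ₄ = (curveE (X : ℤ[X])).preΨ₄ := by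
    rw [curveE_preΨ₄, coe_compRingHom_apply]
    simp
    ring
  rw [WeierstrassCurve.preΨ', ← coe_compRingHom_apply, map_preNormEDS', e₂, e₃, e₄]

lemma negX_divPoly (n : ℕ) : negX (divPoly n) = divPoly n := by
  rw [divPoly_eq, map_mul, negX, coe_mapRingHom, map_C, coe_compRingHom_apply, preΨ'_comp_neg]
  split_ifs <;> simp

/-- `Ψ_n(x)` is an even polynomial. As the `ψ_k` are even, `Ψ_n(-x) = ± Ψ_n(x)`, and the sign is
`+` since `ψ_n` has no root at `x = 0`. -/
lemma primPsi_comp_neg {n : ℕ} (hn : 3 ≤ n) (hsq : Squarefree n) :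
    (primPsi n).comp (-X) = primPsi n := by
  have h := C_primPsi_mul hn hsq
  have h0 := divPoly_ne_zero (n := n) (by omega)
  have hl0 : divPolyLcm n ≠ 0 := right_ne_zero_of_mul (h ▸ h0)
  have hσ : C ((primPsi n).comp (-X)) * negX (divPolyLcm n) = divPoly n := by
    have := congrArg negX h
    rw [map_mul, negX_divPoly] at this
    rw [← this]
    simp [negX]
  have d1 : divPolyLcm n ∣ negX (divPolyLcm n) := Finset.lcm_dvd fun l hl => by
    have := _root_.map_dvd negX (divPoly_dvd_divPolyLcm hl)
    rwa [negX_divPoly] at this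
  have d2 : negX (divPolyLcm n) ∣ divPolyLcm n := by
    have := _root_.map_dvd negX d1
    rwa [negX_negX] at this
  obtain ⟨u, hu⟩ := associated_of_dvd_dvd d1 d2
  obtain ⟨v, hv, hvu⟩ := isUnit_iff.1 u.isUnit
  obtain ⟨w, hw, hwv⟩ := isUnit_iff.1 hv
  obtain ⟨z, hz, hzw⟩ := isUnit_iff.1 hw
  have e : (primPsi n).comp (-X) * v = primPsi n := by
    refine C_injective (mul_right_cancel₀ hl0 ?_)
    rw [h, ← hσ, ← hu, ← hvu, C_mul]
    ring
  have hp : spec (1 : ℤ) 0 (primPsi n) ≠ 0 := by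
    intro hz0
    have := congrArg (spec₃ (1 : ℤ) 0 1) h
    rw [map_mul, spec₃_C, hz0, zero_mul, divPoly_eq, map_mul, spec₃_C] at this
    have hne := spec_one_zero_preΨ'_ne_zero (n := n) (by omega)
    split_ifs at this
    · simp [spec₃] at this
      exact hne this
    · simp at this
      exact hne this.symm
  have hz1 : z = 1 := by
    have := congrArg (spec (1 : ℤ) 0) e
    have hc : spec (1 : ℤ) 0 ((primPsi n).comp (-X)) = spec (1 : ℤ) 0 (primPsi n) := by
      rw [spec_eq_eval, spec_eq_eval, Polynomial.map_comp]
      simp [eval_comp]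
    rw [map_mul, hc, ← hwv, ← hzw] at this
    have hz' : spec (1 : ℤ) 0 (C (C z)) = z := by simp [spec]
    refine mul_left_cancel₀ hp ?_
    rw [mul_one, ← hz', this]
  rw [← hwv, ← hzw, hz1] at e
  simpa using e


lemma primPsi_eq_expand {n : ℕ} (hn : 3 ≤ n) (hsq : Squarefree n) :
    primPsi n = expand ℤ[X] 2 (biPsi n) := by
  ext i : 1
  rw [biPsi, coeff_expand two_pos]
  split_ifs with hi
  · rw [coeff_contract two_ne_zero, Nat.div_mul_cancel hi]
  · have h := congrArg (fun f => f.coeff i) (primPsi_comp_neg hn hsq)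
    have hodd : Odd i := Nat.not_even_iff_odd.1 fun he => hi he.two_dvd
    simp only [← neg_one_mul (X : ℤ[X][X]), ← C_1, ← C_neg, comp_C_mul_X_coeff] at h
    rw [C_neg, C_1, hodd.neg_one_pow] at h
    have h2 : 2 * (primPsi n).coeff i = 0 := by linear_combination -h
    exact (mul_eq_zero.1 h2).resolve_left two_ne_zero

lemma cast_psiVal {R : Type*} [CommRing R] (n : ℕ) (x y : ℤ) :
    ((psiVal n x y : ℤ) : R) = spec (y : R) (x : R) (biPsi n) := by
  have : (Int.castRingHom R).comp (evalEvalRingHom y x) = spec (y : R) (x : R) := by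
    ext <;> simp [spec]
  rw [← this]
  rfl

lemma spec_primPsi {R : Type*} [CommRing R] {n : ℕ} (hn : 3 ≤ n) (hsq : Squarefree n) (u y : ℤ)
    {x : R} (hx : x ^ 2 = u) : spec (y : R) x (primPsi n) = (psiVal n u y : ℤ) := by
  rw [cast_psiVal, primPsi_eq_expand hn hsq, spec_eq_eval, spec_eq_eval, map_expand, expand_eval,
    hx]

variable {L : Type*} [NormedField L] [IsUltrametricDist L]

lemma norm_spec₃_le {a x y : L} (ha : ‖a‖ ≤ 1) (hx : ‖x‖ ≤ 1) (hy : ‖y‖ ≤ 1) (f : ℤ[X][X][X]) :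
    ‖spec₃ a x y f‖ ≤ 1 := by
  have : spec₃ a x y = (unitBall L).subtype.comp (spec₃ ⟨a, ha⟩ ⟨x, hx⟩ ⟨y, hy⟩) := by
    ext <;> simp [spec₃, spec]
  rw [this]
  exact mem_unitBall.1 (SetLike.coe_mem _)

namespace IsKummerSeq

variable {y : L} {z : ℕ → L} {n : ℕ} {u v : ℤ}

/-- In `ψ_n = Ψ_n lcm ψ_{n/l}`, the least common multiple has an integral value, and this value is a
multiple of each `ψ_{n/l}`. -/
lemma norm_kummerW_le_norm_psiVal (hn : 3 ≤ n) (hsq : Squarefree n)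
    (h : IsKummerSeq (v : L) z) (hy : y ^ 2 = z 1 ^ 3 + v * z 1) (hz : z 1 ^ 2 = u) :
    ‖kummerW z (2 * y) n‖ ≤ ‖(psiVal n u v : L)‖ ∧
      ∀ l ∈ n.primeFactors,
        ‖kummerW z (2 * y) n‖ ≤ ‖kummerW z (2 * y) (n / l)‖ * ‖(psiVal n u v : L)‖ := by
  have hb : (2 * y) ^ 2 = 4 * (z 1 ^ 3 + v * z 1) := by rw [← hy]; ring
  have hv1 : ‖(v : L)‖ ≤ 1 := IsUltrametricDist.norm_intCast_le_one _ v
  have hz1 : ‖z 1‖ ≤ 1 := by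
    refine (pow_le_one_iff_of_nonneg (norm_nonneg _) two_ne_zero).1 ?_
    rw [← norm_pow, hz]
    exact IsUltrametricDist.norm_intCast_le_one _ u
  have hy1 : ‖y‖ ≤ 1 := by
    refine (pow_le_one_iff_of_nonneg (norm_nonneg _) two_ne_zero).1 ?_
    rw [← norm_pow, hy]
    have hz2 : z 1 ∈ unitBall L := hz1
    exact add_mem (pow_mem hz2 3) (mul_mem (mem_unitBall.2 hv1) hz2)
  have hle := norm_spec₃_le hv1 hz1 hy1
  have hW : ∀ k, spec₃ (v : L) (z 1) y (divPoly k) = kummerW z (2 * y) k := by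
    intro k
    rw [spec₃_divPoly, h.kummerW_eq_preΨ' hb]
  have e := congrArg (spec₃ (v : L) (z 1) y) (C_primPsi_mul hn hsq)
  rw [map_mul, spec₃_C, spec_primPsi hn hsq u v hz, hW] at e
  constructor
  · rw [← e, norm_mul]
    exact mul_le_of_le_one_right (norm_nonneg _) (hle _)
  · intro l hl
    obtain ⟨c, hc⟩ := divPoly_dvd_divPolyLcm hl
    rw [← e, hc, map_mul, hW, norm_mul, norm_mul, mul_comm, mul_assoc]
    gcongr
    exact mul_le_of_le_one_left (norm_nonneg _) (hle _)

end IsKummerSeq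

end

/-! ### Multiples of a point that reduce to infinity -/

section

variable {L : Type*} [NormedField L] [IsUltrametricDist L]

/-- The two abscissas `s`, `t` of the sum and the difference of two points reducing to infinity,
with abscissas `y`, `z`, are both large. -/
lemma one_lt_norm_of_sum_of_prod {a y z s t : L} (ha : ‖a‖ ≤ 1) (hy : 1 < ‖y‖) (hz : 1 < ‖z‖)
    (hyz : y ≠ z) (hadd : (s + t) * (y - z) ^ 2 = 2 * (y + z) * (y * z + a))
    (hmul : s * t * (y - z) ^ 2 = (y * z - a) ^ 2) : 1 < ‖s‖ := by
  by_contra! hs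
  have hP : 1 < ‖y * z‖ := by rw [norm_mul]; exact one_lt_mul_of_lt_of_le hy hz.le
  have haP : ‖a‖ < ‖y * z‖ := ha.trans_lt hP
  have hD : 0 < ‖y - z‖ ^ 2 := pow_pos (norm_pos_iff.2 (sub_ne_zero.2 hyz)) 2
  have e1 : ‖s‖ * ‖t‖ * ‖y - z‖ ^ 2 = ‖y * z‖ ^ 2 := by
    rw [← norm_pow, ← norm_mul, ← norm_mul, hmul, norm_pow, sub_eq_add_neg,
      IsUltrametricDist.norm_add_eq_max_of_norm_ne_norm (by rw [norm_neg]; exact haP.ne'),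
      norm_neg, max_eq_left haP.le]
  have e2 : ‖s + t‖ * ‖y - z‖ ^ 2 ≤ max ‖y‖ ‖z‖ * ‖y * z‖ := by
    rw [← norm_pow, ← norm_mul, hadd, norm_mul, norm_mul]
    have h2 : ‖(2 : L)‖ ≤ 1 := mem_unitBall.1 (natCast_mem _ 2)
    have h3 : ‖y + z‖ ≤ max ‖y‖ ‖z‖ := IsUltrametricDist.norm_add_le_max _ _
    have h4 : ‖y * z + a‖ ≤ ‖y * z‖ :=
      (IsUltrametricDist.norm_add_le_max _ _).trans (max_le le_rfl haP.le)
    calc ‖(2 : L)‖ * ‖y + z‖ * ‖y * z + a‖ ≤ 1 * max ‖y‖ ‖z‖ * ‖y * z‖ := by gcongr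
      _ = _ := by rw [one_mul]
  have hDle : ‖y - z‖ ≤ max ‖y‖ ‖z‖ := norm_sub_le_max_norm _ _
  have hmax : max ‖y‖ ‖z‖ < ‖y * z‖ := by
    rw [norm_mul]
    exact max_lt (lt_mul_of_one_lt_right (one_pos.trans hy) hz)
      (lt_mul_of_one_lt_left (one_pos.trans hz) hy)
  have ht : ‖y * z‖ ^ 2 ≤ ‖t‖ * ‖y - z‖ ^ 2 := by
    rw [← e1, mul_assoc]
    exact mul_le_of_le_one_left (by positivity) hs
  have ht1 : 1 < ‖t‖ := by
    by_contra! h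
    have h5 : ‖y - z‖ ^ 2 < ‖y * z‖ ^ 2 :=
      pow_lt_pow_left₀ (hDle.trans_lt hmax) (norm_nonneg _) two_ne_zero
    have h6 : ‖t‖ * ‖y - z‖ ^ 2 ≤ ‖y - z‖ ^ 2 := mul_le_of_le_one_left hD.le h
    linarith
  have est : ‖s + t‖ = ‖t‖ := by
    rw [IsUltrametricDist.norm_add_eq_max_of_norm_ne_norm (hs.trans_lt ht1).ne,
      max_eq_right (hs.trans ht1.le)]
  rw [est] at e2
  have h7 : max ‖y‖ ‖z‖ * ‖y * z‖ < ‖y * z‖ ^ 2 := by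
    rw [sq]
    exact mul_lt_mul_of_pos_right hmax (one_pos.trans hP)
  linarith

namespace IsKummerSeq

variable {a : L} {x : ℕ → L}

lemma one_lt_norm_add (h : IsKummerSeq a x) (ha : ‖a‖ ≤ 1) {i j : ℕ} (hj : 1 ≤ j) (hij : j ≤ i)
    (hi1 : 1 < ‖x i‖) (hj1 : 1 < ‖x j‖) : 1 < ‖x (i + j)‖ := by
  obtain rfl | hij := hij.eq_or_lt
  · have hd := congrArg norm (h.dup hj)
    rw [norm_mul, norm_mul, norm_cube_add ha hj1, norm_pow, sub_eq_add_neg,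
      norm_sq_add (by rwa [norm_neg]) hj1] at hd
    have hx0 : 0 < ‖x j‖ := one_pos.trans hj1
    have e : ‖x (2 * j)‖ * ‖(4 : L)‖ = ‖x j‖ := by
      refine mul_right_cancel₀ (pow_pos hx0 3).ne' ?_
      linear_combination hd
    have h4 : ‖(4 : L)‖ ≤ 1 := mem_unitBall.1 (natCast_mem _ 4)
    rw [← two_mul]
    refine hj1.trans_le ?_
    rw [← e]
    exact mul_le_of_le_one_right (norm_nonneg _) h4
  · exact one_lt_norm_of_sum_of_prod ha hi1 hj1 (h.ne hj hij) (h.add hj hij) (h.mul hj hij)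

lemma one_lt_norm_sub (h : IsKummerSeq a x) (ha : ‖a‖ ≤ 1) {i j : ℕ} (hj : 1 ≤ j) (hij : j < i)
    (hi1 : 1 < ‖x i‖) (hj1 : 1 < ‖x j‖) : 1 < ‖x (i - j)‖ := by
  refine one_lt_norm_of_sum_of_prod ha hi1 hj1 (h.ne hj hij) (t := x (i + j)) ?_ ?_
  · rw [add_comm (x (i - j)), h.add hj hij]
  · rw [mul_comm (x (i - j)), h.mul hj hij]

lemma one_lt_norm_mul (h : IsKummerSeq a x) (ha : ‖a‖ ≤ 1) {i : ℕ} (hi : 1 ≤ i)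
    (hi1 : 1 < ‖x i‖) (k : ℕ) : 1 < ‖x ((k + 1) * i)‖ := by
  induction k with
  | zero => simpa using hi1
  | succ k ih =>
    rw [Nat.succ_mul (k + 1)]
    exact h.one_lt_norm_add ha hi (Nat.le_mul_of_pos_left i k.succ_pos) ih hi1

lemma one_lt_norm_of_dvd (h : IsKummerSeq a x) (ha : ‖a‖ ≤ 1) {i j : ℕ} (hj : 1 ≤ j)
    (hij : i ∣ j) (hi1 : 1 < ‖x i‖) : 1 < ‖x j‖ := by
  obtain ⟨k, rfl⟩ := hij
  have hi : 1 ≤ i := Nat.pos_of_mul_pos_right hj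
  have hk : 1 ≤ k := Nat.pos_of_mul_pos_left hj
  obtain ⟨k, rfl⟩ := Nat.exists_eq_add_of_le' hk
  rw [mul_comm]
  exact h.one_lt_norm_mul ha hi hi1 k

lemma one_lt_norm_gcd (h : IsKummerSeq a x) (ha : ‖a‖ ≤ 1) : ∀ {i j : ℕ}, 1 ≤ i → 1 ≤ j →
    1 < ‖x i‖ → 1 < ‖x j‖ → 1 < ‖x (i.gcd j)‖ := by
  have main : ∀ s i j : ℕ, i + j ≤ s → 1 ≤ i → 1 ≤ j → 1 < ‖x i‖ → 1 < ‖x j‖ →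
      1 < ‖x (i.gcd j)‖ := by
    intro s
    induction s with
    | zero => intro i j hs hi; omega
    | succ s ih =>
      intro i j hs hi hj hi1 hj1
      rcases lt_trichotomy i j with hij | rfl | hij
      · have := ih i (j - i) (by omega) hi (by omega) hi1 (h.one_lt_norm_sub ha hi hij hj1 hi1)
        rwa [Nat.gcd_sub_self_right hij.le] at this
      · simpa using hi1
      · have := ih (i - j) j (by omega) (by omega) hj (h.one_lt_norm_sub ha hj hij hi1 hj1) hj1
        rwa [Nat.gcd_sub_self_left hij.le] at this
  exact fun {i j} hi hj hi1 hj1 => main _ i j le_rfl hi hj hi1 hj1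

/-- If the `n`-th multiple reduces to infinity but not for the first time, then so does the
`n / l`-th multiple for some prime `l`. -/
lemma exists_prime_one_lt_norm (h : IsKummerSeq a x) (ha : ‖a‖ ≤ 1) {n k : ℕ} (hk : 1 ≤ k)
    (hkn : k < n) (hn1 : 1 < ‖x n‖) (hk1 : 1 < ‖x k‖) :
    ∃ l ∈ n.primeFactors, 1 < ‖x (n / l)‖ := by
  have hg := h.one_lt_norm_gcd ha (hk.trans hkn.le) hk hn1 hk1
  obtain ⟨c, hc⟩ := Nat.gcd_dvd_left n k
  have hg0 : 0 < n.gcd k := Nat.gcd_pos_of_pos_right n hk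
  have hgn : n.gcd k < n := (Nat.gcd_le_right n hk).trans_lt hkn
  have hc1 : c ≠ 1 := by rintro rfl; omega
  have hl := Nat.minFac_prime hc1
  have hlc := Nat.minFac_dvd c
  have hln : c.minFac ∣ n := hc ▸ hlc.mul_left _
  refine ⟨c.minFac, Nat.mem_primeFactors.2 ⟨hl, hln, by omega⟩,
    h.one_lt_norm_of_dvd ha (Nat.div_pos (Nat.le_of_dvd (by omega) hln) hl.pos) ?_ hg⟩
  obtain ⟨d, hd⟩ := hlc
  refine ⟨d, Nat.div_eq_of_eq_mul_right hl.pos ?_⟩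
  conv_lhs => rw [hc, hd]
  ring

variable {b : L}

/-- The common part of the numerator and the denominator of `x(2 m P)` controls the common part of
those of `x(m P)`. -/
lemma norm_two_mul_le (h : IsKummerSeq a x) (hb : b ^ 2 = 4 * (x 1 ^ 3 + a * x 1)) (ha : ‖a‖ ≤ 1)
    {m : ℕ} (hm : 1 ≤ m) :
    max ‖x (2 * m) * kummerW x b (2 * m) ^ 2‖ (‖kummerW x b (2 * m)‖ ^ 2) ≤
      max ‖x m * kummerW x b m ^ 2‖ (‖kummerW x b m‖ ^ 2) ^ 4 := by
  have e2 := h.kummerW_two_mul_sq hb hm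
  have e1 : x (2 * m) * kummerW x b (2 * m) ^ 2 =
      ((x m * kummerW x b m ^ 2) ^ 2 - a * (kummerW x b m ^ 2) ^ 2) ^ 2 := by
    rw [e2]
    linear_combination kummerW x b m ^ 8 * h.dup hm
  have e3 : kummerW x b (2 * m) ^ 2 = 4 * ((x m * kummerW x b m ^ 2) *
      ((x m * kummerW x b m ^ 2) ^ 2 + a * (kummerW x b m ^ 2) ^ 2)) * kummerW x b m ^ 2 := by
    rw [e2]; ring
  rw [← norm_pow, e1, e3, ← norm_pow (kummerW x b m)]
  generalize x m * kummerW x b m ^ 2 = f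
  generalize kummerW x b m ^ 2 = w
  have hf : ‖f‖ ≤ max ‖f‖ ‖w‖ := le_max_left _ _
  have hw : ‖w‖ ≤ max ‖f‖ ‖w‖ := le_max_right _ _
  have hM : 0 ≤ max ‖f‖ ‖w‖ := (norm_nonneg f).trans hf
  generalize max ‖f‖ ‖w‖ = M at *
  have haw : ‖a * w ^ 2‖ ≤ M ^ 2 := by
    rw [norm_mul, norm_pow]
    exact (mul_le_of_le_one_left (by positivity) ha).trans (pow_le_pow_left₀ (norm_nonneg _) hw 2)
  have hff : ‖f ^ 2‖ ≤ M ^ 2 := by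
    rw [norm_pow]
    exact pow_le_pow_left₀ (norm_nonneg _) hf 2
  have h4 : ‖(4 : L)‖ ≤ 1 := mem_unitBall.1 (natCast_mem _ 4)
  refine max_le ?_ ?_
  · rw [norm_pow, show M ^ 4 = (M ^ 2) ^ 2 by ring]
    refine pow_le_pow_left₀ (norm_nonneg _) ?_ 2
    exact (norm_sub_le_max_norm _ _).trans (max_le hff haw)
  · rw [norm_mul, norm_mul, norm_mul]
    calc ‖(4 : L)‖ * (‖f‖ * ‖f ^ 2 + a * w ^ 2‖) * ‖w‖ ≤ 1 * (M * M ^ 2) * M := by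
          gcongr
          exact (IsUltrametricDist.norm_add_le_max _ _).trans (max_le hff haw)
      _ = M ^ 4 := by ring

end IsKummerSeq

end

/-! ### Common factors of numerators and denominators -/

namespace IsKummerSeq

section

variable {L : Type*} [NormedField L] [IsUltrametricDist L] {a b : L} {x : ℕ → L}

/-- A bound for the common factors of the numerator and the denominator of `x(m P)` if `2 P` reduces
to infinity, or to a finite nonsingular point. In the first case the numerator of `x(2 m P)` is
dominated by its leading term, in the second case the numerator and the denominator of `x(2 m P)`
have nothing in common but a power of `b`; one descends from `2 m P` to `m P`. -/
lemma pow_le_max_of_two {r : ℝ} (h : IsKummerSeq a x) (hb : b ^ 2 = 4 * (x 1 ^ 3 + a * x 1))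
    (ha : ‖a‖ ≤ 1) (hr0 : 0 ≤ r)
    (hr : (r ≤ ‖x 2 * b ^ 2‖ ∧ 1 < ‖x 2‖) ∨ (r ≤ ‖b ^ 2‖ ∧ ‖x 2‖ < 1 ∧ ‖a‖ = 1)) {m : ℕ}
    (hm : 1 ≤ m) : r ^ m ^ 2 ≤ max ‖x m * kummerW x b m ^ 2‖ (‖kummerW x b m‖ ^ 2) ^ 4 := by
  refine le_trans ?_ (h.norm_two_mul_le hb ha hm)
  obtain ⟨b', hb', hW⟩ := h.exists_kummerW_mul hb one_le_two
  have hW2 : kummerW x b 2 = b := by simp [kummerW]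
  rw [hW, hW2]
  have hs := h.subseq one_le_two
  obtain ⟨hr, h2⟩ | ⟨hr, h2, ha1⟩ := hr
  · refine le_max_of_le_left ?_
    obtain ⟨m, rfl⟩ := Nat.exists_eq_add_of_le' hm
    have hΦ := hs.mul_kummerW_sq_eq_Φ (b := b') hb' m
    simp only [mul_one] at hΦ
    rw [show x (2 * (m + 1)) * (kummerW (fun k => x (2 * k)) b' (m + 1) * b ^ (m + 1) ^ 2) ^ 2 =
      x (2 * (m + 1)) * kummerW (fun k => x (2 * k)) b' (m + 1) ^ 2 * (b ^ 2) ^ (m + 1) ^ 2 by ring,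
      hΦ, norm_mul, norm_eval_Φ ha _ h2, norm_pow, ← mul_pow, ← norm_mul]
    exact pow_le_pow_left₀ hr0 hr _
  · have hns := hs.not_norm_lt_one (b := b') hb' ha (by simpa using h2.le) (fun hc => by
      have : ‖x 2 ^ 2‖ < 1 := by
        rw [norm_pow]
        exact pow_lt_one₀ (norm_nonneg _) h2 two_ne_zero
      have h3 : ‖x 2 ^ 2 - (x 2 ^ 2 - a)‖ < 1 :=
        (norm_sub_le_max_norm _ _).trans_lt (max_lt this (by simpa using hc.1))
      rw [sub_sub_cancel, ha1] at h3
      exact lt_irrefl _ h3) hm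
    have e : ∀ t : L, ‖b ^ 2‖ ^ m ^ 2 * ‖t‖ = ‖t * (b ^ 2) ^ m ^ 2‖ := by
      intro t
      rw [norm_mul, norm_pow (b ^ 2), mul_comm]
    calc r ^ m ^ 2 ≤ ‖b ^ 2‖ ^ m ^ 2 * 1 := by
          rw [mul_one]; exact pow_le_pow_left₀ hr0 hr _
      _ ≤ ‖b ^ 2‖ ^ m ^ 2 * max ‖x (2 * m) * kummerW (fun k => x (2 * k)) b' m ^ 2‖
            ‖kummerW (fun k => x (2 * k)) b' m ^ 2‖ := by
          gcongr
          by_contra! hc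
          rw [max_lt_iff, norm_pow (kummerW _ _ _)] at hc
          exact hns ⟨hc.1, (pow_lt_one_iff_of_nonneg (norm_nonneg _) two_ne_zero).1 hc.2⟩
      _ = _ := by
          rw [mul_max_of_nonneg _ _ (by positivity), e, e, ← norm_pow (_ * b ^ m ^ 2)]
          congr 2 <;> ring

end

end IsKummerSeq

lemma norm_intCast_padicAlgCl_lt_one_iff {p : ℕ} [Fact p.Prime] {k : ℤ} :
    ‖(k : PadicAlgCl p)‖ < 1 ↔ (p : ℤ) ∣ k := by
  rw [norm_intCast_padicAlgCl, Padic.norm_intCast_lt_one_iff]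

namespace IsKummerSeq

variable {p : ℕ} [hp : Fact p.Prime] {u v : ℤ} {y : PadicAlgCl p} {z : ℕ → PadicAlgCl p}

/-- The numerator and the denominator of `x(m P)`, written in terms of division polynomials, have no
factor in common at the primes at which the reduction of `P` is nonsingular. -/
lemma one_le_max (h : IsKummerSeq (v : PadicAlgCl p) z) (hy : y ^ 2 = z 1 ^ 3 + v * z 1)
    (hz : z 1 ^ 2 = u) (hns : ¬ ((p : ℤ) ∣ u - v ∧ (p : ℤ) ∣ 16 * (u * (u + v) ^ 2))) {m : ℕ}
    (hm : 1 ≤ m) : 1 ≤ max ‖z m * kummerW z (2 * y) m ^ 2‖ (‖kummerW z (2 * y) m‖ ^ 2) ^ 4 := by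
  have hb : (2 * y) ^ 2 = 4 * (z 1 ^ 3 + v * z 1) := by rw [← hy]; ring
  have hz1 : ‖z 1‖ ≤ 1 := by
    refine (pow_le_one_iff_of_nonneg (norm_nonneg _) two_ne_zero).1 ?_
    rw [← norm_pow, hz]
    exact IsUltrametricDist.norm_intCast_le_one _ u
  have := h.not_norm_lt_one hb (IsUltrametricDist.norm_intCast_le_one _ v) hz1 (fun hc => hns
    ⟨norm_intCast_padicAlgCl_lt_one_iff.1 (by rw [Int.cast_sub, ← hz]; exact hc.1),
      norm_intCast_padicAlgCl_lt_one_iff.1 ?_⟩) hm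
  · refine one_le_pow₀ ?_
    by_contra! hc
    rw [max_lt_iff] at hc
    exact this ⟨hc.1, (pow_lt_one_iff_of_nonneg (norm_nonneg _) two_ne_zero).1 hc.2⟩
  · have e : ((16 * (u * (u + v) ^ 2) : ℤ) : PadicAlgCl p) = (2 * y) ^ 4 := by
      rw [show (2 * y) ^ 4 = ((2 * y) ^ 2) ^ 2 by ring, hb]
      push_cast
      rw [← hz]
      ring
    rw [e, norm_pow]
    exact pow_lt_one₀ (norm_nonneg _) hc.2 four_ne_zero

lemma one_le_max_of_odd (hp2 : p ≠ 2) (h : IsKummerSeq (v : PadicAlgCl p) z)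
    (hy : y ^ 2 = z 1 ^ 3 + v * z 1) (hz : z 1 ^ 2 = u) (huv : IsCoprime u v) {m : ℕ}
    (hm : 1 ≤ m) : 1 ≤ max ‖z m * kummerW z (2 * y) m ^ 2‖ (‖kummerW z (2 * y) m‖ ^ 2) ^ 4 := by
  refine h.one_le_max hy hz (fun ⟨h1, h2⟩ => ?_) hm
  have hpp : Prime (p : ℤ) := Nat.prime_iff_prime_int.1 hp.out
  have hp2' : ¬ (p : ℤ) ∣ 2 := fun hd => hp2 ((Nat.prime_dvd_prime_iff_eq hp.out Nat.prime_two).1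
    (by exact_mod_cast hd))
  have hu : (p : ℤ) ∣ u := by
    rcases hpp.dvd_or_dvd h2 with h2 | h2
    · exact absurd (hpp.dvd_of_dvd_pow (n := 4) (by norm_num; exact h2)) hp2'
    · rcases hpp.dvd_or_dvd h2 with h2 | h2
      · exact h2
      · have h3 : (p : ℤ) ∣ 2 * u := by
          rw [show 2 * u = (u - v) + (u + v) by ring]
          exact dvd_add h1 (hpp.dvd_of_dvd_pow h2)
        exact (hpp.dvd_or_dvd h3).resolve_left hp2'
  have hv : (p : ℤ) ∣ v := by
    rw [show v = u - (u - v) by ring]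
    exact dvd_sub hu h1
  exact hpp.not_isUnit (huv.isUnit_of_dvd' hu hv)

end IsKummerSeq

lemma norm_le_of_two_pow_dvd {k : ℤ} {e : ℕ} (hk : (2 : ℤ) ^ e ∣ k) :
    ‖(k : PadicAlgCl 2)‖ ≤ (1 / 2) ^ e := by
  obtain ⟨c, rfl⟩ := hk
  push_cast
  rw [norm_mul, norm_pow, norm_two_padicAlgCl, one_div]
  exact mul_le_of_le_one_right (by positivity) (IsUltrametricDist.norm_intCast_le_one _ c)

lemma norm_eq_half_of_mod_four {k : ℤ} (hk : k % 4 = 2) : ‖(k : PadicAlgCl 2)‖ = 1 / 2 := by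
  obtain ⟨c, rfl⟩ : (2 : ℤ) ∣ k := by omega
  have : ¬ ‖(c : PadicAlgCl 2)‖ < 1 := by
    rw [norm_intCast_padicAlgCl_lt_one_iff]
    push_cast
    omega
  push_cast
  rw [norm_mul, norm_two_padicAlgCl,
    le_antisymm (IsUltrametricDist.norm_intCast_le_one _ c) (not_lt.1 this), one_div, mul_one]

namespace IsKummerSeq

/-- At the prime `2` the bound is worse, since `P` may have singular reduction. Then `X` and `Y` are
odd and `x(2 P) = (X - Y)² / (4 z₁ (X + Y))`, so that `2 P` reduces to a finite nonsingular point or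
to infinity according as `4` divides `X - Y` or `X + Y`. -/
lemma pow_le_max_of_prime_two {u v : ℤ} {y : PadicAlgCl 2} {z : ℕ → PadicAlgCl 2}
    (h : IsKummerSeq (v : PadicAlgCl 2) z)
    (hy : y ^ 2 = z 1 ^ 3 + v * z 1) (hz : z 1 ^ 2 = u) (huv : IsCoprime u v) {m : ℕ}
    (hm : 1 ≤ m) :
    (1 / 8) ^ m ^ 2 ≤ max ‖z m * kummerW z (2 * y) m ^ 2‖ (‖kummerW z (2 * y) m‖ ^ 2) ^ 4 := by
  have hb : (2 * y) ^ 2 = 4 * (z 1 ^ 3 + v * z 1) := by rw [← hy]; ring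
  by_cases huv2 : (2 : ℤ) ∣ u - v
  swap
  -- the reduction of `P` is nonsingular
  · exact le_trans (pow_le_one₀ (by norm_num) (by norm_num))
      (h.one_le_max hy hz (fun hc => huv2 (by exact_mod_cast hc.1)) hm)
  have hnot : ¬ (2 : ℤ) ∣ u := fun hu => Int.prime_two.not_isUnit (huv.isUnit_of_dvd' hu (by omega))
  have unit : ∀ {k : ℤ}, ¬ (2 : ℤ) ∣ k → ‖(k : PadicAlgCl 2)‖ = 1 := fun {k} hk =>
    le_antisymm (IsUltrametricDist.norm_intCast_le_one _ k)
      (not_lt.1 fun hlt => hk (by exact_mod_cast norm_intCast_padicAlgCl_lt_one_iff.1 hlt))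
  have hv1 : ‖(v : PadicAlgCl 2)‖ = 1 := unit (by omega)
  have hz1 : ‖z 1‖ = 1 := by
    rw [← pow_eq_one_iff_of_nonneg (norm_nonneg _) two_ne_zero, ← norm_pow, hz]
    exact unit hnot
  have hbn : ‖(2 * y) ^ 2‖ = 1 / 4 * ‖((u + v : ℤ) : PadicAlgCl 2)‖ := by
    rw [hb, show (4 : PadicAlgCl 2) * (z 1 ^ 3 + v * z 1) = 2 * 2 * z 1 * (z 1 ^ 2 + v) by ring, hz,
      norm_mul, norm_mul, norm_mul, norm_two_padicAlgCl, hz1]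
    push_cast
    norm_num
  have hd : ‖z 2‖ * ‖(2 * y) ^ 2‖ = ‖((u - v : ℤ) : PadicAlgCl 2)‖ ^ 2 := by
    rw [hb, ← norm_mul, h.dup le_rfl, hz]
    push_cast
    rw [norm_pow]
  refine h.pow_le_max_of_two hb hv1.le (by norm_num) ?_ hm
  by_cases h4 : (4 : ℤ) ∣ u - v
  · right
    rw [norm_eq_half_of_mod_four (k := u + v) (by omega)] at hbn
    have h5 : ‖((u - v : ℤ) : PadicAlgCl 2)‖ ≤ (1 / 2) ^ 2 :=
      norm_le_of_two_pow_dvd (by norm_num; exact h4)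
    have h6 : ‖((u - v : ℤ) : PadicAlgCl 2)‖ ^ 2 ≤ ((1 / 2) ^ 2) ^ 2 :=
      pow_le_pow_left₀ (norm_nonneg _) h5 2
    rw [hbn] at hd ⊢
    exact ⟨by norm_num, by linarith, hv1⟩
  · left
    rw [norm_mul, hd, norm_eq_half_of_mod_four (k := u - v) (by omega)]
    rw [norm_eq_half_of_mod_four (k := u - v) (by omega), hbn] at hd
    have h5 : ‖((u + v : ℤ) : PadicAlgCl 2)‖ ≤ (1 / 2) ^ 2 :=
      norm_le_of_two_pow_dvd (by norm_num; omega)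
    refine ⟨by norm_num, ?_⟩
    by_contra! hle
    have : ‖z 2‖ * (1 / 4 * ‖((u + v : ℤ) : PadicAlgCl 2)‖) ≤ 1 * (1 / 4 * (1 / 2) ^ 2) := by
      gcongr
    linarith

end IsKummerSeq

/-! ### The power of a prime in `Ψ_n(X, Y)` -/

namespace IsKummerSeq

section

variable {L : Type*} [NormedField L] [IsUltrametricDist L] {a b c : L} {x : ℕ → L}

/-- If `m P` reduces to infinity, then the leading term of `ψ_l` dominates its value at `m P`,
so that `ψ_{m l}` has the norm of `l φ_m ^ ((l² - 1) / 2) ψ_m`, where `φ_m = x_m ψ_m²`. The elliptic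
sequence is that of the curve obtained by the change of model `x ↦ c² x`. -/
lemma norm_kummerW_mul_odd (h : IsKummerSeq a x) (hc : c ≠ 0) (ha : ‖a‖ ≤ 1)
    (hb : b ^ 2 = 4 * ((c ^ 2 * x 1) ^ 3 + c ^ 4 * a * (c ^ 2 * x 1))) {m l : ℕ} (hm : 1 ≤ m)
    (hl : Odd l) (hx : 1 < ‖(l : L)‖ * ‖x m‖) :
    ‖kummerW (fun k => c ^ 2 * x k) b (m * l)‖ =
      ‖(l : L)‖ * ‖c ^ 2 * x m * kummerW (fun k => c ^ 2 * x k) b m ^ 2‖ ^ ((l ^ 2 - 1) / 2) *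
        ‖kummerW (fun k => c ^ 2 * x k) b m‖ := by
  have hc3 := pow_ne_zero 3 hc
  have hb' : (b / c ^ 3) ^ 2 = 4 * (x 1 ^ 3 + a * x 1) := by
    rw [div_pow, hb]
    field_simp
  have e := fun k => kummerW_scale (x := x) (b := b / c ^ 3) c hc k
  simp only [mul_div_cancel₀ _ hc3] at e
  have e1 := e (m * l)
  have e2 := e m
  generalize kummerW (fun k => c ^ 2 * x k) b (m * l) = s at *
  generalize kummerW (fun k => c ^ 2 * x k) b m = t at *
  rw [h.kummerW_mul_odd hb' hm hl] at e1
  have hpre := norm_eval_preΨ' ha hl hx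
  obtain ⟨D, hD⟩ : ∃ D, l ^ 2 = 2 * D + 1 := hl.pow
  rw [show (l ^ 2 - 1) / 2 = D by omega] at *
  have e3 : s * c = ((curveE a).preΨ' l).eval (x m) * (t * c) ^ l ^ 2 := by
    rw [e1, e2, mul_pow, mul_pow, pow_mul, mul_assoc]
  rw [hD] at e3
  have hc' : ‖c‖ ≠ 0 := norm_ne_zero_iff.2 hc
  refine mul_right_cancel₀ hc' ?_
  rw [← norm_mul s, e3, norm_mul, hpre]
  simp only [norm_mul, norm_pow]
  ring

/-- If `P` reduces to infinity, then the leading term dominates the numerator of `x(m P)`. The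
elliptic sequence is that of the curve obtained by the change of model `x ↦ c² x`. -/
lemma norm_mul_kummerW_sq (h : IsKummerSeq a x) (hc : c ≠ 0) (ha : ‖a‖ ≤ 1)
    (hb : b ^ 2 = 4 * ((c ^ 2 * x 1) ^ 3 + c ^ 4 * a * (c ^ 2 * x 1))) {m : ℕ} (hm : 1 ≤ m)
    (hx : 1 < ‖x 1‖) :
    ‖c ^ 2 * x m * kummerW (fun k => c ^ 2 * x k) b m ^ 2‖ = ‖c ^ 2 * x 1‖ ^ m ^ 2 := by
  have hc3 := pow_ne_zero 3 hc
  have hb' : (b / c ^ 3) ^ 2 = 4 * (x 1 ^ 3 + a * x 1) := by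
    rw [div_pow, hb]
    field_simp
  have e := kummerW_scale (x := x) (b := b / c ^ 3) c hc m
  simp only [mul_div_cancel₀ _ hc3] at e
  obtain ⟨m, rfl⟩ := Nat.exists_eq_add_of_le' hm
  have hΦ := h.mul_kummerW_sq_eq_Φ hb' m
  have e3 : c ^ 2 * x (m + 1) * kummerW (fun k => c ^ 2 * x k) b (m + 1) ^ 2 =
      (c ^ 2) ^ (m + 1) ^ 2 * ((curveE a).Φ (m + 1 : ℕ)).eval (x 1) := by
    rw [← hΦ, show c ^ 2 * x (m + 1) * kummerW (fun k => c ^ 2 * x k) b (m + 1) ^ 2 =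
      x (m + 1) * (kummerW (fun k => c ^ 2 * x k) b (m + 1) * c) ^ 2 by ring, e]
    ring
  rw [e3, norm_mul, norm_eval_Φ ha _ hx, norm_pow, norm_mul, mul_pow]

/-- The upper bound for the power of a prime in `Ψ_n(X, Y)`, on the model `x ↦ c² x` on which the
abscissa of `P` is a square root of `X = u` and the coefficient of the curve is `Y = v`. The
hypothesis `hM` bounds the common factors of the numerators and the denominators of the multiples of
`P`. If `n P` does not reduce to infinity, it bounds `ψ_n` itself from below. If already `(n / l) P`
reduces to infinity, it bounds the numerator of `x((n / l) P)`, whose powers are all that `ψ_n`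
contains beyond `l ψ_{n/l}`. -/
lemma le_norm_psiVal {C : ℝ} {u v : ℤ} {y : L} {n : ℕ} (hn : 3 ≤ n) (hsq : Squarefree n)
    (h : IsKummerSeq a x) (hc : c ≠ 0) (ha : ‖a‖ ≤ 1)
    (hu : (c ^ 2 * x 1) ^ 2 = u) (hv : c ^ 4 * a = v) (hmax : 1 ≤ max ‖(u : L)‖ ‖(v : L)‖)
    (hy : y ^ 2 = (c ^ 2 * x 1) ^ 3 + v * (c ^ 2 * x 1)) (hC0 : 0 ≤ C) (hC1 : C ≤ 1)
    (hM : ∀ m, 1 ≤ m → C ^ m ^ 2 ≤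
      max ‖c ^ 2 * x m * kummerW (fun k => c ^ 2 * x k) (2 * y) m ^ 2‖
        (‖kummerW (fun k => c ^ 2 * x k) (2 * y) m‖ ^ 2) ^ 4) :
    psiVal n u v ≠ 0 ∧
    (‖x n‖ ≤ 1 → C ^ n ^ 2 ≤ max (‖c‖ ^ 8) 1 * ‖(psiVal n u v : L)‖ ^ 8) ∧
    ∀ l ∈ n.primeFactors, 1 < ‖(l : L)‖ * ‖x (n / l)‖ →
      ‖(l : L)‖ ^ 8 * C ^ n ^ 2 ≤ ‖(psiVal n u v : L)‖ ^ 8 := by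
  have hs : IsKummerSeq (v : L) (fun k => c ^ 2 * x k) := by
    have := h.scale (pow_ne_zero 2 hc)
    rwa [← pow_mul, hv] at this
  have hb : (2 * y) ^ 2 = 4 * ((c ^ 2 * x 1) ^ 3 + v * (c ^ 2 * x 1)) := by rw [← hy]; ring
  have hb' : (2 * y) ^ 2 = 4 * ((c ^ 2 * x 1) ^ 3 + c ^ 4 * a * (c ^ 2 * x 1)) := by rw [hb, hv]
  obtain ⟨hN1, hN2⟩ := hs.norm_kummerW_le_norm_psiVal hn hsq hy hu
  have hpos : ∀ {k}, 1 ≤ k → 0 < ‖kummerW (fun k => c ^ 2 * x k) (2 * y) k‖ := fun hk =>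
    norm_pos_iff.2 (hs.kummerW_ne_zero' hb hk)
  have hu1 : ‖(u : L)‖ ≤ 1 := IsUltrametricDist.norm_intCast_le_one _ u
  have hv1 : ‖(v : L)‖ ≤ 1 := IsUltrametricDist.norm_intCast_le_one _ v
  have hc0 : 0 < ‖c‖ := norm_pos_iff.2 hc
  have hun : ‖(u : L)‖ = ‖c ^ 2 * x 1‖ ^ 2 := by rw [← hu, norm_pow]
  have hvn : ‖(v : L)‖ = ‖c‖ ^ 4 * ‖a‖ := by rw [← hv, norm_mul, norm_pow]
  refine ⟨fun h0 => ?_, fun hxn => ?_, fun l hl hlx => ?_⟩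
  · rw [h0, Int.cast_zero, norm_zero] at hN1
    exact (hpos (by omega)).not_ge hN1
  · refine (hM n (by omega)).trans ?_
    have : max ‖c ^ 2 * x n * kummerW (fun k => c ^ 2 * x k) (2 * y) n ^ 2‖
        (‖kummerW (fun k => c ^ 2 * x k) (2 * y) n‖ ^ 2) ≤
        max (‖c‖ ^ 2) 1 * ‖(psiVal n u v : L)‖ ^ 2 := by
      refine max_le ?_ ?_
      · rw [norm_mul, norm_mul, norm_pow, norm_pow]
        have : ‖c‖ ^ 2 * ‖x n‖ ≤ max (‖c‖ ^ 2) 1 :=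
          (mul_le_of_le_one_right (by positivity) hxn).trans (le_max_left _ _)
        gcongr
      · refine (pow_le_pow_left₀ (norm_nonneg _) hN1 2).trans ?_
        exact le_mul_of_one_le_left (by positivity) (le_max_right _ _)
    refine (pow_le_pow_left₀ (le_max_of_le_right (by positivity)) this 4).trans ?_
    rw [mul_pow, ← pow_mul]
    gcongr
    rcases le_total (‖c‖ ^ 2) 1 with h1 | h1
    · rw [max_eq_right h1, one_pow]
      exact le_max_right _ _
    · rw [max_eq_left h1, ← pow_mul]
      exact le_max_left _ _
  · have hlp := Nat.prime_of_mem_primeFactors hl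
    have hln := Nat.dvd_of_mem_primeFactors hl
    have hm : 1 ≤ n / l := Nat.div_pos (Nat.le_of_dvd (by omega) hln) hlp.pos
    have hN := hN2 l hl
    have hnl : n / l * l = n := Nat.div_mul_cancel hln
    generalize n / l = m at *
    have hl1 : ‖(l : L)‖ ≤ 1 := mem_unitBall.1 (natCast_mem _ l)
    have hxm : 1 < ‖x m‖ := hlx.trans_le (mul_le_of_le_one_left (norm_nonneg _) hl1)
    -- the numerator of `x(m P)` is the larger of the two terms in the bound `hM`
    have hφ : C ^ m ^ 2 ≤
        ‖c ^ 2 * x m * kummerW (fun k => c ^ 2 * x k) (2 * y) m ^ 2‖ ^ 4 := by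
      by_cases hx1 : 1 < ‖x 1‖
      · have huv : ‖(v : L)‖ < ‖(u : L)‖ := by
          rw [hun, hvn, norm_mul, norm_pow, mul_pow, ← pow_mul]
          refine mul_lt_mul_of_pos_left ?_ (pow_pos hc0 _)
          exact ha.trans_lt (one_lt_pow₀ hx1 two_ne_zero)
        rw [max_eq_left huv.le, hun] at hmax
        rw [h.norm_mul_kummerW_sq hc ha hb' hm hx1]
        refine (pow_le_one₀ hC0 hC1).trans (one_le_pow₀ (one_le_pow₀ ?_))
        exact (one_le_pow_iff_of_nonneg (norm_nonneg _) two_ne_zero).1 hmax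
      · rw [not_lt] at hx1
        have hc1 : 1 ≤ ‖c‖ ^ 4 := by
          refine hmax.trans (max_le ?_ ?_)
          · rw [hun, norm_mul, norm_pow, mul_pow, ← pow_mul]
            exact mul_le_of_le_one_right (by positivity) (pow_le_one₀ (norm_nonneg _) hx1)
          · rw [hvn]
            exact mul_le_of_le_one_right (by positivity) ha
        have hc1' : 1 ≤ ‖c‖ := (one_le_pow_iff_of_nonneg hc0.le four_ne_zero).1 hc1
        have hM' := hM m hm
        rwa [max_eq_left] at hM'
        rw [norm_mul, norm_mul, norm_pow, norm_pow]
        refine le_mul_of_one_le_left (by positivity) ?_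
        exact one_le_mul_of_one_le_of_one_le (one_le_pow₀ hc1') hxm.le
    have hW := hpos hm
    have hCn : C ^ n ^ 2 = (C ^ m ^ 2) ^ l ^ 2 := by rw [← hnl, mul_pow, pow_mul]
    rw [hCn]
    have hC0' : 0 ≤ C ^ m ^ 2 := by positivity
    have hC1' : C ^ m ^ 2 ≤ 1 := pow_le_one₀ hC0 hC1
    generalize hF : ‖c ^ 2 * x m * kummerW (fun k => c ^ 2 * x k) (2 * y) m ^ 2‖ = F at *
    have hF0 : 0 ≤ F := hF ▸ norm_nonneg _
    generalize C ^ m ^ 2 = D at *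
    rcases hlp.eq_two_or_odd' with rfl | hodd
    · -- `ψ_{2 m}² = 4 φ_m (φ_m² + a ψ_m⁴) ψ_m²`
      have e := congrArg norm (hs.kummerW_two_mul_sq hb hm)
      rw [mul_comm 2 m, hnl, ← hv, show (4 : L) * ((c ^ 2 * x m) ^ 3 + c ^ 4 * a * (c ^ 2 * x m)) =
        (2 : ℕ) ^ 2 * (c ^ 6 * (x m ^ 3 + a * x m)) by push_cast; ring, norm_mul, norm_mul,
        norm_mul (c ^ 6), norm_cube_add ha hxm] at e
      simp only [norm_pow] at e
      have e2 : ‖kummerW (fun k => c ^ 2 * x k) (2 * y) n‖ ^ 2 = ‖((2 : ℕ) : L)‖ ^ 2 * F ^ 3 *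
          ‖kummerW (fun k => c ^ 2 * x k) (2 * y) m‖ ^ 2 := by
        rw [e, ← hF]
        simp only [norm_mul, norm_pow]
        ring
      have e3 : ‖((2 : ℕ) : L)‖ ^ 2 * F ^ 3 ≤ ‖(psiVal n u v : L)‖ ^ 2 := by
        refine le_of_mul_le_mul_right ?_ (pow_pos hW 2)
        rw [← e2, mul_comm (_ ^ 2), ← mul_pow]
        exact pow_le_pow_left₀ (norm_nonneg _) hN 2
      calc ‖((2 : ℕ) : L)‖ ^ 8 * D ^ 2 ^ 2 ≤ ‖((2 : ℕ) : L)‖ ^ 8 * (F ^ 4) ^ 3 := by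
            gcongr ?_ * ?_
            exact (pow_le_pow_of_le_one hC0' hC1' (by norm_num : 3 ≤ 2 ^ 2)).trans
              (pow_le_pow_left₀ hC0' hφ 3)
        _ = (‖((2 : ℕ) : L)‖ ^ 2 * F ^ 3) ^ 4 := by ring
        _ ≤ (‖(psiVal n u v : L)‖ ^ 2) ^ 4 := pow_le_pow_left₀ (by positivity) e3 4
        _ = _ := by ring
    · have e := h.norm_kummerW_mul_odd hc ha hb' hm hodd hlx
      obtain ⟨d, hd⟩ : ∃ d, l ^ 2 = 2 * d + 1 := hodd.pow
      rw [hnl, hF, show (l ^ 2 - 1) / 2 = d by omega] at e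
      rw [e, mul_comm] at hN
      have e3 := le_of_mul_le_mul_left hN hW
      calc ‖(l : L)‖ ^ 8 * D ^ l ^ 2 ≤ ‖(l : L)‖ ^ 8 * (F ^ 4) ^ (2 * d) := by
            gcongr ?_ * ?_
            exact (pow_le_pow_of_le_one hC0' hC1' (by omega)).trans
              (pow_le_pow_left₀ hC0' hφ _)
        _ = (‖(l : L)‖ * F ^ d) ^ 8 := by ring
        _ ≤ ‖(psiVal n u v : L)‖ ^ 8 := pow_le_pow_left₀ (by positivity) e3 8

end

end IsKummerSeq

/-! ### Rational points -/

lemma xCoord_eq_absc {a : ℚ} (P : (curveE a).toAffine.Point) : xCoord P = absc P := by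
  cases P <;> rfl

section

variable (p : ℕ) [hp : Fact p.Prime]

lemma one_lt_norm_of_dvd_den {q : ℚ} (h : p ∣ q.den) : 1 < ‖(q : ℚ_[p])‖ := by
  have hd : ‖(q.den : ℚ_[p])‖ < 1 := Padic.norm_natCast_lt_one_iff.2 h
  have hn : ‖(q.num : ℚ_[p])‖ = 1 := by
    refine le_antisymm (Padic.norm_int_le_one _) (not_lt.1 fun hlt => ?_)
    rw [Padic.norm_intCast_lt_one_iff] at hlt
    exact Nat.not_coprime_of_dvd_of_dvd hp.out.one_lt (Int.natCast_dvd.1 hlt) h q.reduced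
  by_contra! hq
  have e : (q : ℚ_[p]) * (q.den : ℚ_[p]) = (q.num : ℚ_[p]) := by
    exact_mod_cast q.mul_den_eq_num
  have := congrArg norm e
  rw [norm_mul, hn] at this
  have h2 : ‖(q : ℚ_[p])‖ * ‖(q.den : ℚ_[p])‖ ≤ ‖(q.den : ℚ_[p])‖ :=
    mul_le_of_le_one_left (norm_nonneg _) hq
  linarith

lemma dvd_den_of_one_lt_norm {q : ℚ} (h : 1 < ‖(q : ℚ_[p])‖) : p ∣ q.den := by
  by_contra hd
  exact absurd (Padic.norm_rat_le_one hd) (not_le.2 h)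

/-- The denominator of the abscissa of a rational point is a square, hence divisible by `p²` if it
is divisible by `p`. -/
lemma one_lt_norm_mul_norm_of_dvd_den {a : ℤ} {q r : ℚ} (hr : r ^ 2 = q ^ 3 + a * q)
    (h : p ∣ q.den) : 1 < ‖(p : ℚ_[p])‖ * ‖(q : ℚ_[p])‖ := by
  have h1 := one_lt_norm_of_dvd_den p h
  have hr' : (r : ℚ_[p]) ^ 2 = (q : ℚ_[p]) ^ 3 + (a : ℚ_[p]) * q := by
    have := congrArg (Rat.cast : ℚ → ℚ_[p]) hr
    push_cast at this
    exact this
  have e := congrArg norm hr'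
  rw [norm_cube_add (Padic.norm_int_le_one a) h1, norm_pow] at e
  have hq0 : (q : ℚ_[p]) ≠ 0 := norm_pos_iff.1 (one_pos.trans h1)
  have hr0 : (r : ℚ_[p]) ≠ 0 := by
    intro h0
    rw [h0, norm_zero, zero_pow two_ne_zero] at e
    exact (pow_pos (one_pos.trans h1) 3).ne e
  have hp1 : (1 : ℝ) < p := by exact_mod_cast hp.out.one_lt
  rw [Padic.norm_eq_zpow_neg_valuation hq0, Padic.norm_eq_zpow_neg_valuation hr0,
    ← zpow_natCast, ← zpow_natCast, ← zpow_mul, ← zpow_mul] at e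
  have e' := zpow_right_injective₀ (one_pos.trans hp1) hp1.ne' e
  rw [Padic.norm_eq_zpow_neg_valuation hq0] at h1 ⊢
  rw [one_lt_zpow_iff_right₀ hp1] at h1
  rw [Padic.norm_p, ← zpow_neg_one, ← zpow_add₀ (one_pos.trans hp1).ne',
    one_lt_zpow_iff_right₀ hp1]
  push_cast at e'
  omega

end

section

variable {a : ℤ} {q : ℚ}

lemma gcd_coord_ne_zero (ha : a ≠ 0) (q : ℚ) :
    ((Int.gcd (q.num ^ 2) (a * (q.den : ℤ) ^ 2) : ℕ) : ℤ) ≠ 0 := by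
  rw [Int.natCast_ne_zero, Ne, Int.gcd_eq_zero_iff]
  rintro ⟨-, h⟩
  exact mul_ne_zero ha (pow_ne_zero 2 (by exact_mod_cast q.den_nz)) h

lemma coordX_mul_gcd (a : ℤ) (q : ℚ) :
    coordX a q * (Int.gcd (q.num ^ 2) (a * (q.den : ℤ) ^ 2) : ℕ) = q.num ^ 2 :=
  Int.ediv_mul_cancel (Int.gcd_dvd_left _ _)

lemma coordY_mul_gcd (a : ℤ) (q : ℚ) :
    coordY a q * (Int.gcd (q.num ^ 2) (a * (q.den : ℤ) ^ 2) : ℕ) = a * (q.den : ℤ) ^ 2 :=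
  Int.ediv_mul_cancel (Int.gcd_dvd_right _ _)

lemma isCoprime_coord (ha : a ≠ 0) (q : ℚ) : IsCoprime (coordX a q) (coordY a q) := by
  rw [Int.isCoprime_iff_gcd_eq_one]
  exact Int.gcd_div_gcd_div_gcd (Int.gcd_pos_iff.2 (Or.inr
    (mul_ne_zero ha (pow_ne_zero 2 (by exact_mod_cast q.den_nz)))))

end

lemma FourthPowerFree.ne_zero {a : ℤ} (ha : FourthPowerFree a) : a ≠ 0 := by
  rintro rfl
  exact ha 2 Nat.prime_two (dvd_zero _)

/-- The exponent of `p` in a fourth-power-free integer is at most `3`. -/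
lemma FourthPowerFree.le_norm {a : ℤ} (ha : FourthPowerFree a) (p : ℕ) [hp : Fact p.Prime] :
    1 ≤ (p : ℝ) ^ 3 * ‖(a : ℚ_[p])‖ := by
  have hp0 : (0 : ℝ) < p := by exact_mod_cast hp.out.pos
  have ha0 : (a : ℚ_[p]) ≠ 0 := by exact_mod_cast ha.ne_zero
  have h := ha p hp.out
  rw [← Padic.norm_int_le_pow_iff_dvd, Padic.norm_eq_zpow_neg_valuation ha0,
    zpow_le_zpow_iff_right₀ (by exact_mod_cast hp.out.one_lt)] at h
  rw [Padic.norm_eq_zpow_neg_valuation ha0, ← zpow_natCast, ← zpow_add₀ hp0.ne']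
  refine one_le_zpow₀ (by exact_mod_cast hp.out.one_lt.le) ?_
  push_cast at h ⊢
  omega

/-- The estimate for the power of `p` in `Ψ_n(X, Y)`. The first alternative occurs if `p` does not
divide `B_n`, and its constant `p ^ 6` is due to the fourth-power-freeness of `a`. If `p` divides
`B_n`, then it also divides `B_{n/l}` for some prime `l`. -/
lemma padic_estimate {a : ℤ} (ha : FourthPowerFree a) {P : (curveE (a : ℚ)).toAffine.Point}
    (hP : ¬ IsOfFinAddOrder P) {n : ℕ} (hn : 3 ≤ n) (hsq : Squarefree n)
    (hB : ¬ HasPrimitiveDivisor (edsB P) n) (p : ℕ) [hp : Fact p.Prime] :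
    psiVal n (coordX a (xCoord P)) (coordY a (xCoord P)) ≠ 0 ∧
    ((if p = 2 then 1 / 8 else 1) ^ n ^ 2 ≤
        (p : ℝ) ^ 6 * ‖(psiVal n (coordX a (xCoord P)) (coordY a (xCoord P)) : ℚ_[p])‖ ^ 8 ∨
      ∃ l ∈ n.primeFactors, ‖(l : ℚ_[p])‖ ^ 8 * (if p = 2 then 1 / 8 else 1) ^ n ^ 2 ≤
        ‖(psiVal n (coordX a (xCoord P)) (coordY a (xCoord P)) : ℚ_[p])‖ ^ 8) := by
  have huv := isCoprime_coord ha.ne_zero (xCoord P)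
  have hX := coordX_mul_gcd a (xCoord P)
  have hY := coordY_mul_gcd a (xCoord P)
  have hg := gcd_coord_ne_zero ha.ne_zero (xCoord P)
  generalize ((Int.gcd ((xCoord P).num ^ 2) (a * ((xCoord P).den : ℤ) ^ 2) : ℕ) : ℤ) = g at *
  generalize coordX a (xCoord P) = u at *
  generalize coordY a (xCoord P) = v at *
  set q := xCoord P with hq
  have hg' : (g : PadicAlgCl p) ≠ 0 := by exact_mod_cast hg
  have hd' : (q.den : PadicAlgCl p) ≠ 0 := by exact_mod_cast q.den_nz
  -- the model on which the abscissa of `P` is a square root of `X`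
  obtain ⟨c, hc4⟩ := IsAlgClosed.exists_pow_nat_eq ((q.den : PadicAlgCl p) ^ 2 / g) four_pos
  have hc : c ≠ 0 := by
    rintro rfl
    rw [zero_pow four_ne_zero] at hc4
    exact div_ne_zero (pow_ne_zero 2 hd') hg' hc4.symm
  let x : ℕ → PadicAlgCl p := fun k => ((absc (k • P) : ℚ) : PadicAlgCl p)
  have h : IsKummerSeq (a : PadicAlgCl p) x := by
    have := (isKummerSeq_absc hP).map (Rat.castHom (PadicAlgCl p))
    simpa using this
  have ha1 : ‖(a : PadicAlgCl p)‖ ≤ 1 := IsUltrametricDist.norm_intCast_le_one _ a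
  have hx1 : x 1 * q.den = q.num := by
    have : x 1 = (q : PadicAlgCl p) := by
      simp only [x, one_smul, hq, xCoord_eq_absc]
    rw [this]
    exact_mod_cast q.mul_den_eq_num
  have hu : (c ^ 2 * x 1) ^ 2 = u := by
    have e : (u : PadicAlgCl p) * g = (q.num : PadicAlgCl p) ^ 2 := by
      have := congrArg (Int.cast : ℤ → PadicAlgCl p) hX
      push_cast at this
      exact this
    rw [mul_pow, ← pow_mul, show c ^ (2 * 2) = _ from hc4, eq_comm, ← mul_left_inj' hg', e, ← hx1]
    field_simp
  have hv : c ^ 4 * (a : PadicAlgCl p) = v := by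
    have e : (v : PadicAlgCl p) * g = a * (q.den : PadicAlgCl p) ^ 2 := by
      have := congrArg (Int.cast : ℤ → PadicAlgCl p) hY
      push_cast at this
      exact this
    rw [hc4, eq_comm, ← mul_left_inj' hg', e]
    field_simp
  obtain ⟨y, hy⟩ := IsAlgClosed.exists_pow_nat_eq ((c ^ 2 * x 1) ^ 3 + v * (c ^ 2 * x 1)) two_pos
  have hs : IsKummerSeq (v : PadicAlgCl p) (fun k => c ^ 2 * x k) := by
    have := h.scale (pow_ne_zero 2 hc)
    rwa [← pow_mul, hv] at this
  have hmax : 1 ≤ max ‖(u : PadicAlgCl p)‖ ‖(v : PadicAlgCl p)‖ := by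
    by_contra! hlt
    rw [max_lt_iff, norm_intCast_padicAlgCl_lt_one_iff,
      norm_intCast_padicAlgCl_lt_one_iff] at hlt
    exact (Nat.prime_iff_prime_int.1 hp.out).not_isUnit (huv.isUnit_of_dvd' hlt.1 hlt.2)
  have hM : ∀ m, 1 ≤ m → (if p = 2 then (1 / 8 : ℝ) else 1) ^ m ^ 2 ≤
      max ‖c ^ 2 * x m * kummerW (fun k => c ^ 2 * x k) (2 * y) m ^ 2‖
        (‖kummerW (fun k => c ^ 2 * x k) (2 * y) m‖ ^ 2) ^ 4 := by
    intro m hm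
    split_ifs with hp2
    · subst hp2
      exact hs.pow_le_max_of_prime_two hy hu huv hm
    · rw [one_pow]
      exact hs.one_le_max_of_odd hp2 hy hu huv hm
  obtain ⟨h0, h1, h2⟩ := h.le_norm_psiVal hn hsq hc ha1 hu hv hmax hy
    (by split_ifs <;> norm_num) (by split_ifs <;> norm_num) hM
  rw [norm_intCast_padicAlgCl] at h1 h2
  refine ⟨h0, ?_⟩
  have hxn : ∀ k, ‖x k‖ = ‖((absc (k • P) : ℚ) : ℚ_[p])‖ := fun k => norm_ratCast_padicAlgCl p _
  have hden : ∀ k, edsB P k = (absc (k • P)).den := fun k => by rw [edsB, xCoord_eq_absc]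
  by_cases hpn : p ∣ edsB P n
  · right
    -- `p` is not a primitive divisor
    obtain ⟨k, hk, hkp⟩ : ∃ k ∈ Finset.Ico 1 n, p ∣ edsB P k := by
      by_contra hno
      refine hB ⟨p, hp.out, hpn, fun hdvd => hno ?_⟩
      exact (hp.out.prime.dvd_finsetProd_iff _).1 hdvd
    rw [Finset.mem_Ico] at hk
    rw [hden] at hpn hkp
    obtain ⟨l, hl, hlx⟩ := h.exists_prime_one_lt_norm ha1 hk.1 hk.2
      (by rw [hxn]; exact one_lt_norm_of_dvd_den p hpn)
      (by rw [hxn]; exact one_lt_norm_of_dvd_den p hkp)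
    refine ⟨l, hl, ?_⟩
    rw [← norm_natCast_padicAlgCl]
    refine h2 l hl ?_
    -- if `p = l`, then `1 < ‖x (n / p)‖` has to be improved by a factor `p`
    by_cases hlp : p = l
    · subst hlp
      rw [hxn] at hlx ⊢
      have hdvd := dvd_den_of_one_lt_norm p hlx
      rw [norm_natCast_padicAlgCl]
      generalize (n / p) • P = Q at *
      rcases Q with _ | ⟨s, t, hst⟩
      · exact absurd hlx (by simp [absc])
      · exact one_lt_norm_mul_norm_of_dvd_den p (curveE_equation hst.1) hdvd
    · have : ‖(l : PadicAlgCl p)‖ = 1 := by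
        rw [norm_natCast_padicAlgCl, Padic.norm_natCast_eq_one_iff]
        exact (Nat.coprime_primes hp.out (Nat.prime_of_mem_primeFactors hl)).2 hlp
      rwa [this, one_mul]
  · left
    refine (h1 ?_).trans ?_
    · rw [hxn]
      rw [hden] at hpn
      exact Padic.norm_rat_le_one hpn
    · gcongr
      have hp1 : (1 : ℝ) ≤ p := by exact_mod_cast hp.out.one_lt.le
      refine max_le ?_ (one_le_pow₀ hp1)
      have e1 := ha.le_norm p
      have e2 : ‖c‖ ^ 4 * ‖(a : ℚ_[p])‖ ≤ 1 := by
        rw [← norm_intCast_padicAlgCl, ← norm_pow, ← norm_mul, hv]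
        exact IsUltrametricDist.norm_intCast_le_one _ v
      have e3 : ‖c‖ ^ 4 ≤ (p : ℝ) ^ 3 := by
        calc ‖c‖ ^ 4 ≤ ‖c‖ ^ 4 * ((p : ℝ) ^ 3 * ‖(a : ℚ_[p])‖) :=
              le_mul_of_one_le_right (by positivity) e1
          _ = (p : ℝ) ^ 3 * (‖c‖ ^ 4 * ‖(a : ℚ_[p])‖) := by ring
          _ ≤ (p : ℝ) ^ 3 := mul_le_of_le_one_right (by positivity) e2
      calc ‖c‖ ^ 8 = (‖c‖ ^ 4) ^ 2 := by ring
        _ ≤ ((p : ℝ) ^ 3) ^ 2 := pow_le_pow_left₀ (by positivity) e3 2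
        _ = _ := by ring

lemma norm_le_of_pow_dvd {p : ℕ} [Fact p.Prime] {N : ℤ} {k : ℕ} (h : (p : ℤ) ^ k ∣ N) :
    ‖(N : ℚ_[p])‖ ≤ ((p : ℝ) ^ k)⁻¹ := by
  have := (Padic.norm_int_le_pow_iff_dvd N k).2 h
  rwa [zpow_neg, zpow_natCast] at this

/-- An odd prime divides `Ψ_n(X, Y)` at most once. -/
lemma odd_prime_estimate {a : ℤ} (ha : FourthPowerFree a) {P : (curveE (a : ℚ)).toAffine.Point}
    (hP : ¬ IsOfFinAddOrder P) {n : ℕ} (hn : 3 ≤ n) (hsq : Squarefree n)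
    (hB : ¬ HasPrimitiveDivisor (edsB P) n) {p : ℕ} (hp : p.Prime) (hp2 : p ≠ 2) {k : ℕ}
    (hk : 1 ≤ k)
    (h : (p : ℤ) ^ k ∣ psiVal n (coordX a (xCoord P)) (coordY a (xCoord P))) :
    p ∈ n.primeFactors ∧ k ≤ 1 := by
  have := Fact.mk hp
  have hN := norm_le_of_pow_dvd h
  have hp1 : (1 : ℝ) < p := by exact_mod_cast hp.one_lt
  have hp0 : (0 : ℝ) < p := one_pos.trans hp1
  have hN8 : ‖(psiVal n (coordX a (xCoord P)) (coordY a (xCoord P)) : ℚ_[p])‖ ^ 8 ≤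
      ((p : ℝ) ^ (8 * k))⁻¹ := by
    rw [mul_comm, pow_mul, ← inv_pow]
    exact pow_le_pow_left₀ (norm_nonneg _) hN 8
  rcases (padic_estimate ha hP hn hsq hB p).2 with h1 | ⟨l, hl, h1⟩
  · rw [if_neg hp2, one_pow] at h1
    have h2 : (1 : ℝ) ≤ (p : ℝ) ^ 6 * ((p : ℝ) ^ (8 * k))⁻¹ :=
      h1.trans (mul_le_mul_of_nonneg_left hN8 (by positivity))
    rw [← div_eq_mul_inv, one_le_div (by positivity), pow_le_pow_iff_right₀ hp1] at h2
    omega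
  · rw [if_neg hp2, one_pow, mul_one] at h1
    have h2 := h1.trans hN8
    by_cases hlp : p = l
    · subst hlp
      refine ⟨hl, ?_⟩
      rw [Padic.norm_p, inv_pow, inv_le_inv₀ (by positivity) (by positivity),
        pow_le_pow_iff_right₀ hp1] at h2
      omega
    · rw [Padic.norm_natCast_eq_one_iff.2
        ((Nat.coprime_primes hp (Nat.prime_of_mem_primeFactors hl)).2 hlp), one_pow,
        one_le_inv₀ (by positivity)] at h2
      have : (1 : ℝ) < (p : ℝ) ^ (8 * k) := one_lt_pow₀ hp1 (by omega)
      linarith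

/-- The exponent of `2` in `Ψ_n(X, Y)` is at most `1 + 3 n² / 8`. -/
lemma two_estimate {a : ℤ} (ha : FourthPowerFree a) {P : (curveE (a : ℚ)).toAffine.Point}
    (hP : ¬ IsOfFinAddOrder P) {n : ℕ} (hn : 3 ≤ n) (hsq : Squarefree n)
    (hB : ¬ HasPrimitiveDivisor (edsB P) n) {k : ℕ}
    (h : (2 : ℤ) ^ k ∣ psiVal n (coordX a (xCoord P)) (coordY a (xCoord P))) :
    8 * k ≤ 8 + 3 * n ^ 2 := by
  have hN := norm_le_of_pow_dvd (p := 2) (by exact_mod_cast h)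
  have hN8 : ‖(psiVal n (coordX a (xCoord P)) (coordY a (xCoord P)) : ℚ_[2])‖ ^ 8 ≤
      ((2 : ℝ) ^ (8 * k))⁻¹ := by
    rw [mul_comm, pow_mul, ← inv_pow]
    exact pow_le_pow_left₀ (norm_nonneg _) (by exact_mod_cast hN) 8
  suffices hs : ((2 : ℝ) ^ 8)⁻¹ * (1 / 8) ^ n ^ 2 ≤ ((2 : ℝ) ^ (8 * k))⁻¹ by
    rw [show (1 / 8 : ℝ) = (2 ^ 3)⁻¹ by norm_num, inv_pow, ← mul_inv, ← pow_mul, ← pow_add,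
      inv_le_inv₀ (by positivity) (by positivity), pow_le_pow_iff_right₀ one_lt_two] at hs
    exact hs
  rcases (padic_estimate ha hP hn hsq hB 2).2 with h1 | ⟨l, hl, h1⟩
  · rw [if_pos rfl] at h1
    calc ((2 : ℝ) ^ 8)⁻¹ * (1 / 8) ^ n ^ 2 ≤ ((2 : ℝ) ^ 6)⁻¹ * (1 / 8) ^ n ^ 2 := by
          gcongr <;> norm_num
      _ ≤ ((2 : ℝ) ^ 6)⁻¹ * (((2 : ℕ) : ℝ) ^ 6 * ((2 : ℝ) ^ (8 * k))⁻¹) := by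
          gcongr
          exact h1.trans (mul_le_mul_of_nonneg_left hN8 (by positivity))
      _ = _ := by
          push_cast
          rw [inv_mul_cancel_left₀ (by positivity)]
  · rw [if_pos rfl] at h1
    refine le_trans ?_ (h1.trans hN8)
    gcongr
    rw [← inv_pow]
    refine pow_le_pow_left₀ (by positivity) ?_ 8
    by_cases hl2 : 2 = l
    · subst hl2
      rw [Padic.norm_p]
      push_cast
      exact le_rfl
    · rw [Padic.norm_natCast_eq_one_iff.2
        ((Nat.coprime_primes Nat.prime_two (Nat.prime_of_mem_primeFactors hl)).2 hl2)]
      norm_num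

theorem mainTheorem3 (a : ℤ) (ha : FourthPowerFree a)
    (P : (curveE (a : ℚ)).toAffine.Point) (hP : ¬ IsOfFinAddOrder P)
    (n : ℕ) (hn : 3 ≤ n) (hsq : Squarefree n)
    (hB : ¬ HasPrimitiveDivisor (edsB P) n) :
    ∃ (ε : ℤˣ) (α : ℕ → ℕ),
      psiVal n (coordX a (xCoord P)) (coordY a (xCoord P)) =
        (ε : ℤ) * (2 ^ α 2 * ∏ l ∈ n.primeFactors.erase 2, (l : ℤ) ^ α l) ∧
      (α 2 : ℚ) ≤ 75 / 4 * (n : ℚ) ^ 2 - 59 ∧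
      ∀ l ∈ n.primeFactors.erase 2, (α l : ℚ) ≤ 45 / 4 * (n : ℚ) ^ 2 - 35 := by
  have h0 : psiVal n (coordX a (xCoord P)) (coordY a (xCoord P)) ≠ 0 :=
    (padic_estimate ha hP hn hsq hB 2).1
  have h2 := fun k => two_estimate ha hP hn hsq hB (k := k)
  have ho := fun p hp hp2 k hk => odd_prime_estimate ha hP hn hsq hB (p := p) hp hp2 (k := k) hk
  generalize psiVal n (coordX a (xCoord P)) (coordY a (xCoord P)) = N at *
  have hN0 : N.natAbs ≠ 0 := Int.natAbs_ne_zero.2 h0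
  have hdvd : ∀ p : ℕ, (p : ℤ) ^ N.natAbs.factorization p ∣ N := fun p => by
    rw [← Nat.cast_pow, Int.natCast_dvd]
    exact Nat.ordProj_dvd _ _
  have hn3 : (3 : ℚ) ≤ n := by exact_mod_cast hn
  obtain ⟨ε, hε⟩ : ∃ ε : ℤˣ, N = ε * N.natAbs := by
    rcases Int.natAbs_eq N with h | h
    · exact ⟨1, by simpa using h⟩
    · exact ⟨-1, by simpa using h⟩
  refine ⟨ε, N.natAbs.factorization, ?_, ?_, fun l hl => ?_⟩
  · have hsupp : N.natAbs.factorization.support ⊆ insert 2 (n.primeFactors.erase 2) := by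
      intro p hp
      rw [Nat.support_factorization] at hp
      by_cases hp2 : p = 2
      · exact hp2 ▸ Finset.mem_insert_self _ _
      · have hpp := Nat.prime_of_mem_primeFactors hp
        refine Finset.mem_insert_of_mem (Finset.mem_erase.2 ⟨hp2, ?_⟩)
        refine (ho p hpp hp2 1 le_rfl ?_).1
        rw [pow_one]
        exact Int.natCast_dvd.2 (Nat.dvd_of_mem_primeFactors hp)
    have e := Nat.prod_factorization_pow_eq_self hN0
    rw [Finsupp.prod_of_support_subset _ hsupp _ (by simp),
      Finset.prod_insert (Finset.notMem_erase _ _)] at e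
    conv_lhs => rw [hε, ← e]
    push_cast
    rfl
  · have h3 : (8 * N.natAbs.factorization 2 : ℚ) ≤ 8 + 3 * (n : ℚ) ^ 2 := by
      exact_mod_cast h2 _ (hdvd 2)
    nlinarith
  · have h3 : (N.natAbs.factorization l : ℚ) ≤ 1 := by
      rcases Nat.eq_zero_or_pos (N.natAbs.factorization l) with hz | hpos
      · rw [hz]; norm_num
      · exact_mod_cast (ho l (Nat.prime_of_mem_primeFactors (Finset.mem_of_mem_erase hl))
          (Finset.ne_of_mem_erase hl) _ hpos (hdvd l)).2
    nlinarith
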